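/- All groups are finite. For subgroups $A,B$ of a group, $A$ permutes with $B$ if $AB=BA$. A subgroup $H$ of a group $X$ is S-permutable in $X$ if $H$ permutes with every Sylow subgroup of $X$; it is SS-permutable (respectively, NSS-permutable) in $X$ if there is a subgroup (respectively, a normal subgroup) $S$ of $X$ with $X=HS$ such that $H$ permutes with every Sylow subgroup of $S$. A group $G$ is a PST-group if S-permutability is transitive in $G$: whenever $H\le K\le G$, $H$ is S-permutable in $K$ and $K$ is S-permutable in $G$, then $H$ is S-permutable in $G$. **Theorem C.** Let $G$ be a finite group. Then the following statements are equivalent: 1. For every prime $p$ dividing $|G|$ and all $p$-subgroups $H\le K$ of $G$, $H$ is SS-permutable in the normalizer $N_G(K)$. 2. For every prime $p$ dividing $|G|$ and all $p$-subgroups $H\le K$ of $G$, $H$ is NSS-permutable in $N_G(K)$. 3. $G$ is a solvable PST-group. -/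

import Mathlib

open scoped Pointwise

/-- `H` permutes with `K`: `HK = KH` as sets of products. -/
def Subgroup.PermutesWith {G : Type*} [Group G] (H K : Subgroup G) : Prop :=
  (H : Set G) * (K : Set G) = (K : Set G) * (H : Set G)

/-- `H` permutes with every Sylow subgroup (for every prime) of the subgroup `K`. A Sylow subgroup
of `K` is a subgroup of the group `↥K`; `Subgroup.map K.subtype` regards it as a subgroup of `G`. -/
def Subgroup.PermutesWithSylowsOf {G : Type*} [Group G] (H K : Subgroup G) : Prop :=
  ∀ p : ℕ, p.Prime → ∀ P : Sylow p K, H.PermutesWith ((P : Subgroup K).map K.subtype)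

/-- `H` is S-permutable in the whole group `G`: it permutes with every Sylow subgroup of `G`. -/
def Subgroup.IsSPermutable {G : Type*} [Group G] (H : Subgroup G) : Prop :=
  ∀ p : ℕ, p.Prime → ∀ P : Sylow p G, H.PermutesWith (P : Subgroup G)

/-- `K` is a supplement of `H` in the whole group `G`: `G = HK`. -/
def Subgroup.IsSupplement {G : Type*} [Group G] (H K : Subgroup G) : Prop :=
  (H : Set G) * (K : Set G) = Set.univ

/-- `H` is SS-permutable in the whole group `G`. -/
def Subgroup.IsSSPermutable {G : Type*} [Group G] (H : Subgroup G) : Prop :=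
  ∃ K : Subgroup G, H.IsSupplement K ∧ H.PermutesWithSylowsOf K

/-- `H` is NSS-permutable in the whole group `G`. -/
def Subgroup.IsNSSPermutable {G : Type*} [Group G] (H : Subgroup G) : Prop :=
  ∃ K : Subgroup G, K.Normal ∧ H.IsSupplement K ∧ H.PermutesWithSylowsOf K

/-- `G` is a PST-group: S-permutability is transitive in `G`. For `H ≤ K`, the subgroup `H`
regarded as a subgroup of the group `↥K` is `H.subgroupOf K`. -/
def IsPSTGroup (G : Type*) [Group G] : Prop :=
  ∀ H K : Subgroup G, H ≤ K → (H.subgroupOf K).IsSPermutable → K.IsSPermutable → H.IsSPermutable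

/-! The proof runs through a local and a global condition. Local (`HasLocalPowerAction`): elements
of order prime to p that normalise a p-subgroup K leave every subgroup of K invariant. Global
(`Subgroup.IsPowerHall`, the structure in Agrawal's theorem): an abelian normal Hall subgroup L with
nilpotent quotient and every subgroup of L normal in G.

SS-permutability in N_G(K) gives the local condition. A supplement of a p-group has p-power index,
so it contains Sylow q-subgroups of N_G(K) for q ≠ p; and a q-subgroup that normalises K and
permutes with H ≤ K normalises H. Conversely, under the local condition N_G(K) itself serves as the
normal supplement.

The local condition forces solvability. For the smallest prime p dividing the order, p'-elements
centralise the p-subgroups they normalise, so a Sylow p-subgroup controls its own fusion, and the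
focal subgroup theorem makes the derived subgroup proper.

Both the local condition and the PST property imply `HasQuotientPowerAction`: in every quotient,
p'-elements act by powers on normal p-subgroups. In a solvable group this yields, for each prime p,
a normal p-complement or a normal abelian Sylow p-subgroup whose subgroups are all normal in G. The
decisive fact is `IsPGroup.eq_one_or_comm_of_mem_zpowers`: a nontrivial p'-automorphism acting by
powers exists only on abelian p-groups, and there each k is a power of its own commutator.
Intersecting the complements over the primes of the first kind only gives L.

Given L, a subgroup is S-permutable exactly when L normalises it. Transitivity of S-permutability
follows, and so does the local condition. -/

open scoped commutatorElement

universe u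

/-! ### Reduction to elements of prime power order -/

section PrimePower

variable {G : Type*} [Group G]

theorem Subgroup.mem_of_pow_mem_of_coprime (S : Subgroup G) {x : G} {m n : ℕ} (hmn : m.Coprime n)
    (hm : x ^ m ∈ S) (hn : x ^ n ∈ S) : x ∈ S := by
  have h := Nat.gcd_eq_gcd_ab m n
  rw [hmn.gcd_eq_one] at h
  have hx : x = (x ^ m) ^ (m.gcdA n) * (x ^ n) ^ (m.gcdB n) := by
    rw [← zpow_natCast, ← zpow_natCast, ← zpow_mul, ← zpow_mul, ← zpow_add, ← h]
    simp
  rw [hx]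
  exact S.mul_mem (S.zpow_mem hm _) (S.zpow_mem hn _)

/-- A subgroup containing every power of prime power order of `x` contains `x`. -/
theorem Subgroup.mem_of_forall_prime_pow_orderOf [Finite G] (S : Subgroup G) (x : G)
    (h : ∀ (q k : ℕ), q.Prime → ∀ y ∈ Subgroup.zpowers x, orderOf y = q ^ k → y ∈ S) : x ∈ S := by
  suffices H : ∀ n : ℕ, ∀ y ∈ Subgroup.zpowers x, orderOf y = n → y ∈ S from
    H _ x (Subgroup.mem_zpowers x) rfl
  intro n
  induction n using Nat.recOnPosPrimePosCoprime with
  | zero => intro y _ hy; exact absurd hy (orderOf_pos y).ne'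
  | one => intro y _ hy; rw [orderOf_eq_one_iff] at hy; rw [hy]; exact S.one_mem
  | prime_pow p k hp hk => intro y hyx hy; exact h p k hp y hyx hy
  | coprime a b ha hb hab iha ihb =>
    intro y hyx hy
    refine S.mem_of_pow_mem_of_coprime hab (ihb _ (pow_mem hyx a) ?_) (iha _ (pow_mem hyx b) ?_)
    · rw [orderOf_pow_of_dvd (by lia) (hy ▸ Dvd.intro _ rfl), hy, Nat.mul_div_cancel_left _ (by lia)]
    · rw [orderOf_pow_of_dvd (by lia) (hy ▸ Dvd.intro_left _ rfl), hy,
        Nat.mul_div_cancel _ (by lia)]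

theorem Subgroup.le_of_forall_prime_pow_orderOf [Finite G] {H S : Subgroup G}
    (h : ∀ (q k : ℕ), q.Prime → ∀ y ∈ H, orderOf y = q ^ k → y ∈ S) : H ≤ S := fun x hx =>
  S.mem_of_forall_prime_pow_orderOf x fun q k hq y hy hk =>
    h q k hq y ((Subgroup.zpowers_le.mpr hx) hy) hk

/-- A subgroup containing a Sylow `p`-subgroup and all elements of order prime to `p` is
everything. -/
theorem Sylow.eq_top_of_le_of_coprime_mem [Finite G] {p : ℕ} [Fact p.Prime] (P : Sylow p G)
    {S : Subgroup G} (hP : (P : Subgroup G) ≤ S)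
    (hS : ∀ x : G, (orderOf x).Coprime p → x ∈ S) : S = ⊤ := by
  rw [← Subgroup.index_eq_one]
  by_contra hne
  obtain ⟨q, hq, hqd⟩ := Nat.exists_prime_and_dvd hne
  by_cases hqp : q = p
  · subst hqp
    exact P.not_dvd_index (hqd.trans (Subgroup.index_dvd_of_le hP))
  · have := Fact.mk hq
    let Q : Sylow q G := default
    refine Q.not_dvd_index (hqd.trans (Subgroup.index_dvd_of_le fun x hx => hS x ?_))
    have := Q.2.orderOf_coprime ((Nat.coprime_primes hq Fact.out).mpr hqp) ⟨x, hx⟩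
    rwa [Subgroup.orderOf_mk] at this

theorem Sylow.exists_mem_of_orderOf_eq {q k : ℕ} {x : G} (hx : orderOf x = q ^ k) :
    ∃ Q : Sylow q G, x ∈ Q := by
  have : IsPGroup q (Subgroup.zpowers x) := IsPGroup.of_card (n := k) (by rw [Nat.card_zpowers, hx])
  obtain ⟨Q, hQ⟩ := this.exists_le_sylow
  exact ⟨Q, hQ (Subgroup.mem_zpowers x)⟩

end PrimePower

/-! ### Power automorphisms of order prime to p -/

section PowerAutomorphism

variable {P : Type*} [Group P]

theorem MulAut.pow_apply_eq_zpow (φ : MulAut P) {k : P} {m : ℤ} (h : φ k = k ^ m) (j : ℕ) :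
    (φ ^ j) k = k ^ (m ^ j) := by
  induction j with
  | zero => simp
  | succ j ih => rw [pow_succ', MulAut.mul_apply, ih, map_zpow, h, ← zpow_mul, pow_succ']

/-- From m ≡ 1 mod p follows m ^ p ^ e ≡ 1 mod p ^ e, so φ ^ p ^ e fixes k; as the order of φ is
prime to p, φ is a power of φ ^ p ^ e. -/
theorem MulAut.apply_eq_self_of_dvd_sub_one {p : ℕ} (φ : MulAut P)
    (hφ : (orderOf φ).Coprime p) {k : P} (hk : ∃ e, k ^ p ^ e = 1) {m : ℤ} (h : φ k = k ^ m)
    (hm : (p : ℤ) ∣ m - 1) : φ k = k := by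
  obtain ⟨e, he⟩ := hk
  have h1 : φ ^ p ^ e ∈ MulAction.stabilizer (MulAut P) k := by
    rw [MulAction.mem_stabilizer_iff, MulAut.smul_def, φ.pow_apply_eq_zpow h]
    have hd := (pow_dvd_pow (p : ℤ) (Nat.le_succ e)).trans (dvd_sub_pow_of_dvd_sub hm e)
    obtain ⟨c, hc⟩ := hd
    rw [one_pow] at hc
    rw [show m ^ p ^ e = 1 + p ^ e * c by rw [← hc]; ring, zpow_add, zpow_mul, zpow_one]
    have : k ^ ((p : ℤ) ^ e) = 1 := by exact_mod_cast he
    rw [this, one_zpow, mul_one]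
  have h2 : φ ^ orderOf φ ∈ MulAction.stabilizer (MulAut P) k := by
    rw [pow_orderOf_eq_one]; exact one_mem _
  exact Subgroup.mem_of_pow_mem_of_coprime _ (hφ.pow_right e) h2 h1

theorem IsPGroup.dvd_of_zpow_eq_one {p : ℕ} [Fact p.Prime] (hP : IsPGroup p P) {k : P} (hk : k ≠ 1)
    {n : ℤ} (h : k ^ n = 1) : (p : ℤ) ∣ n :=
  (Int.natCast_dvd_natCast.mpr (hP.dvd_orderOf hk)).trans (orderOf_dvd_iff_zpow_eq_one.mpr h)

theorem IsPGroup.mem_zpowers_zpow {p : ℕ} [hp : Fact p.Prime] (hP : IsPGroup p P) (k : P) {n : ℤ}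
    (hn : ¬ (p : ℤ) ∣ n) : k ∈ Subgroup.zpowers (k ^ n) := by
  obtain ⟨e, he⟩ := hP k
  have hc : IsCoprime n ((p : ℤ) ^ e) :=
    (((Nat.prime_iff_prime_int.mp hp.out).coprime_iff_not_dvd.mpr hn).symm).pow_right
  obtain ⟨u, v, huv⟩ := hc
  refine Subgroup.mem_zpowers_iff.mpr ⟨u, ?_⟩
  have : k ^ ((p : ℤ) ^ e) = 1 := by exact_mod_cast he
  calc (k ^ n) ^ u = k ^ (u * n + v * p ^ e) := by
        rw [zpow_add, mul_comm v, zpow_mul k _ v, this, one_zpow, mul_one, mul_comm, zpow_mul]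
    _ = k := by rw [huv, zpow_one]

/-- All nontrivial elements of a finite `p`-group are raised to the same power modulo `p` by an
automorphism preserving every cyclic subgroup. -/
theorem IsPGroup.exists_uniform_exponent [Finite P] [Nontrivial P] {p : ℕ} [hp : Fact p.Prime]
    (hP : IsPGroup p P) (φ : MulAut P) (h : ∀ k, φ k ∈ Subgroup.zpowers k) :
    ∃ i : ℤ, ¬ (p : ℤ) ∣ i ∧ ∀ k : P, k ≠ 1 → ∀ m : ℤ, φ k = k ^ m → (p : ℤ) ∣ m - i := by
  -- A central element z of order p is the yardstick: i is its exponent, and every other exponent is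
  -- compared with it.
  have := hP.center_nontrivial
  have hpc : p ∣ Nat.card (Subgroup.center P) :=
    ((hP.to_subgroup _).card_eq_or_dvd).resolve_left (Finite.one_lt_card (α := Subgroup.center P)).ne'
  obtain ⟨⟨z, hzc⟩, hz⟩ := exists_prime_orderOf_dvd_card' p hpc
  rw [Subgroup.orderOf_mk] at hz
  have hz1 : z ≠ 1 := by rintro rfl; rw [orderOf_one] at hz; exact hp.out.one_lt.ne hz
  obtain ⟨i, hi⟩ := Subgroup.mem_zpowers_iff.mp (h z)
  have hdz : ∀ n : ℤ, (p : ℤ) ∣ n → z ^ n = 1 := fun n hn =>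
    orderOf_dvd_iff_zpow_eq_one.mp (by rwa [hz])
  refine ⟨i, fun hpi => hz1 ?_, fun k hk m hm => ?_⟩
  · rw [hdz i hpi] at hi
    exact φ.injective (by rw [← hi, map_one])
  have hcomm : Commute k z := (Subgroup.mem_center_iff.mp hzc k)
  by_cases hd : ∃ j : ℤ, k ^ j ≠ 1 ∧ k ^ j ∈ Subgroup.zpowers z
  · obtain ⟨j, hj1, hj⟩ := hd
    obtain ⟨s, hs⟩ := Subgroup.mem_zpowers_iff.mp hj
    have e1 : φ (k ^ j) = (k ^ j) ^ m := by rw [map_zpow, hm, ← zpow_mul, ← zpow_mul, mul_comm]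
    have e2 : φ (k ^ j) = (k ^ j) ^ i := by
      rw [← hs, map_zpow, ← hi, ← zpow_mul, ← zpow_mul, mul_comm]
    refine hP.dvd_of_zpow_eq_one hj1 ?_
    rw [zpow_sub, ← e1, e2, mul_inv_cancel]
  -- Here ⟨k⟩ and ⟨z⟩ meet trivially. The exponent s of k * z satisfies k ^ (m - s) = z ^ (s - i),
  -- which is therefore 1, so m ≡ s ≡ i mod p.
  · push Not at hd
    obtain ⟨s, hs⟩ := Subgroup.mem_zpowers_iff.mp (h (k * z))
    rw [map_mul, hm, ← hi, hcomm.mul_zpow] at hs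
    have e : k ^ (m - s) = z ^ (s - i) := by
      rw [zpow_sub, zpow_sub]
      have h1 : k ^ m = k ^ s * z ^ s * (z ^ i)⁻¹ := by rw [hs]; group
      have c : Commute (z ^ s * (z ^ i)⁻¹) (k ^ s)⁻¹ :=
        ((hcomm.symm.zpow_zpow s s).mul_left (hcomm.symm.zpow_zpow i s).inv_left).inv_right
      rw [h1, mul_assoc (k ^ s), mul_assoc (k ^ s), c.eq]
      group
    have hk1 : k ^ (m - s) = 1 := by
      by_contra hne
      exact hd _ hne (e ▸ Subgroup.zpow_mem_zpowers z _)
    have a1 := hP.dvd_of_zpow_eq_one hk hk1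
    have a2 := hP.dvd_of_zpow_eq_one hz1 (e ▸ hk1)
    have := dvd_add a1 a2
    rwa [sub_add_sub_cancel] at this

theorem commutatorElement_zpow_zpow {g h : P} (hg : Commute g ⁅g, h⁆) (hh : Commute h ⁅g, h⁆)
    (k m : ℤ) : ⁅g ^ k, h ^ m⁆ = ⁅g, h⁆ ^ (k * m) := by
  have h1 : ∀ k : ℤ, g ^ k * h * (g ^ k)⁻¹ = ⁅g, h⁆ ^ k * h := by
    have e : h * g * h⁻¹ = ⁅g, h⁆⁻¹ * g := by rw [commutatorElement_def]; group
    intro k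
    have e2 : h * g ^ k * h⁻¹ = (⁅g, h⁆ ^ k)⁻¹ * g ^ k := by
      rw [← conj_zpow, e, (hg.inv_right.symm).mul_zpow, inv_zpow]
    have e3 : h * (g ^ k)⁻¹ * h⁻¹ = (g ^ k)⁻¹ * ⁅g, h⁆ ^ k := by
      rw [← inv_inj, mul_inv_rev, mul_inv_rev, mul_inv_rev, inv_inv, inv_inv, ← mul_assoc, e2]
    calc g ^ k * h * (g ^ k)⁻¹ = g ^ k * (h * (g ^ k)⁻¹ * h⁻¹) * h := by group
      _ = ⁅g, h⁆ ^ k * h := by rw [e3]; group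
  have h2 : g ^ k * h ^ m * (g ^ k)⁻¹ = ⁅g, h⁆ ^ (k * m) * h ^ m := by
    rw [← conj_zpow, h1 k, (hh.symm.zpow_left k).mul_zpow, ← zpow_mul]
  rw [commutatorElement_def, h2]
  group

/-- An automorphism of order prime to `p` of a finite `p`-group that preserves every subgroup is
trivial unless the group is abelian, in which case it acts without fixed points. -/
theorem IsPGroup.eq_one_or_comm_of_mem_zpowers [Finite P] {p : ℕ} [hp : Fact p.Prime]
    (hP : IsPGroup p P) (φ : MulAut P) (hφ : (orderOf φ).Coprime p)
    (h : ∀ k, φ k ∈ Subgroup.zpowers k) :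
    φ = 1 ∨ ((∀ a b : P, a * b = b * a) ∧ ∀ k : P, k ∈ Subgroup.zpowers (φ k * k⁻¹)) := by
  rcases subsingleton_or_nontrivial P with hs | hn
  · exact Or.inl (MulEquiv.ext fun k => Subsingleton.elim _ _)
  obtain ⟨i, hpi, hi⟩ := hP.exists_uniform_exponent φ h
  choose m hm using fun k => Subgroup.mem_zpowers_iff.mp (h k)
  by_cases hi1 : (p : ℤ) ∣ i - 1
  · refine Or.inl (MulEquiv.ext fun k => ?_)
    by_cases hk : k = 1
    · rw [hk, map_one, map_one]
    have hd := dvd_add (hi k hk (m k) (hm k).symm) hi1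
    rw [sub_add_sub_cancel] at hd
    exact φ.apply_eq_self_of_dvd_sub_one hφ (hP k) (hm k).symm hd
  refine Or.inr ⟨?_, fun k => ?_⟩
  -- Take g in the second centre but not in the centre, and x not commuting with g. The central
  -- element ⁅g, x⁆ ≠ 1 is raised to the product of the exponents of g and x, so i ≡ i² mod p,
  -- whereas i is neither 0 nor 1 mod p.
  · by_contra hna
    have hZ : Subgroup.center P ≠ ⊤ := fun htop => hna fun a b =>
      (Subgroup.mem_center_iff.mp (htop ▸ Subgroup.mem_top b : b ∈ Subgroup.center P) a)
    have : Nontrivial (P ⧸ Subgroup.center P) := QuotientGroup.nontrivial_iff.mpr hZ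
    have := (hP.to_quotient (Subgroup.center P)).center_nontrivial
    obtain ⟨⟨gb, hgb⟩, hgb1⟩ := exists_ne (1 : Subgroup.center (P ⧸ Subgroup.center P))
    obtain ⟨g, rfl⟩ := QuotientGroup.mk_surjective gb
    have hgZ : g ∉ Subgroup.center P := fun hg =>
      hgb1 (Subtype.ext ((QuotientGroup.eq_one_iff g).mpr hg))
    have hcZ : ∀ x : P, ⁅g, x⁆ ∈ Subgroup.center P := fun x => by
      rw [← QuotientGroup.eq_one_iff, commutatorElement_def]
      have := Subgroup.mem_center_iff.mp hgb (x : P ⧸ Subgroup.center P)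
      rw [QuotientGroup.mk_mul, QuotientGroup.mk_mul, QuotientGroup.mk_mul, ← this]
      simp
    rw [Subgroup.mem_center_iff] at hgZ
    push Not at hgZ
    obtain ⟨x, hx⟩ := hgZ
    have hc1 : ⁅g, x⁆ ≠ 1 := fun h1 => hx (commutatorElement_eq_one_iff_mul_comm.mp h1).symm
    have hg1 : g ≠ 1 := by rintro rfl; simp at hx
    have hx1 : x ≠ 1 := by rintro rfl; simp at hx
    have key : φ ⁅g, x⁆ = ⁅g, x⁆ ^ (m g * m x) := by
      rw [map_commutatorElement, ← hm g, ← hm x]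
      exact commutatorElement_zpow_zpow (Subgroup.mem_center_iff.mp (hcZ x) g)
        (Subgroup.mem_center_iff.mp (hcZ x) x) _ _
    have d1 := hi _ hc1 _ key
    have d2 := hi g hg1 _ (hm g).symm
    have d3 := hi x hx1 _ (hm x).symm
    have d4 : (p : ℤ) ∣ i * (i - 1) := by
      have : i * (i - 1) = (m g * m x - i) - (m g - i) * m x - i * (m x - i) := by ring
      rw [this]
      exact dvd_sub (dvd_sub d1 (d2.mul_right _)) (d3.mul_left _)
    rcases (Nat.prime_iff_prime_int.mp hp.out).dvd_or_dvd d4 with h' | h'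
    · exact hpi h'
    · exact hi1 h'
  · by_cases hk : k = 1
    · rw [hk]; exact one_mem _
    have : φ k * k⁻¹ = k ^ (m k - 1) := by rw [zpow_sub, zpow_one, hm]
    rw [this]
    refine hP.mem_zpowers_zpow k fun hd => hi1 ?_
    have := dvd_sub hd (hi k hk (m k) (hm k).symm)
    rwa [sub_sub_sub_cancel_left] at this

/-- The conjugation form of `IsPGroup.eq_one_or_comm_of_mem_zpowers`. -/
theorem IsPGroup.commute_or_comm_of_conj_mem_zpowers {K : Subgroup P} [Finite K] {p : ℕ}
    [hp : Fact p.Prime] (hK : IsPGroup p K) {x : P} (hx : x ∈ Subgroup.normalizer (K : Set P))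
    (hxp : (orderOf x).Coprime p) (h : ∀ k ∈ K, x * k * x⁻¹ ∈ Subgroup.zpowers k) :
    (∀ k ∈ K, x * k = k * x) ∨ ((∀ a ∈ K, ∀ b ∈ K, a * b = b * a) ∧
      ∀ k ∈ K, k ∈ Subgroup.zpowers (x * k * x⁻¹ * k⁻¹)) := by
  have hcoe : ∀ k : K, ((K.normalizerMonoidHom ⟨x, hx⟩ k : K) : P) = x * k * x⁻¹ := fun k => rfl
  have hz : ∀ (a b : K), a ∈ Subgroup.zpowers b ↔ (a : P) ∈ Subgroup.zpowers (b : P) := by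
    intro a b
    simp only [Subgroup.mem_zpowers_iff, ← Subgroup.coe_zpow, Subtype.coe_inj]
  rcases hK.eq_one_or_comm_of_mem_zpowers (K.normalizerMonoidHom ⟨x, hx⟩)
    (hxp.coprime_dvd_left ((orderOf_map_dvd _ _).trans (by rw [Subgroup.orderOf_mk])))
    (fun k => (hz _ _).mpr (by rw [hcoe]; exact h k k.2)) with h1 | ⟨h1, h2⟩
  · refine Or.inl fun k hk => ?_
    have := hcoe ⟨k, hk⟩
    rw [h1] at this
    exact mul_inv_eq_iff_eq_mul.mp this.symm
  · refine Or.inr ⟨fun a ha b hb => congrArg Subtype.val (h1 ⟨a, ha⟩ ⟨b, hb⟩), fun k hk => ?_⟩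
    exact (hz _ _).mp (h2 ⟨k, hk⟩)

end PowerAutomorphism

/-! ### Permuting subgroups and supplements -/

section Permute

variable {G : Type*} [Group G]

theorem Subgroup.PermutesWith.symm {H K : Subgroup G} (h : H.PermutesWith K) : K.PermutesWith H :=
  Eq.symm h

theorem Subgroup.PermutesWith.coe_sup {H K : Subgroup G} (h : H.PermutesWith K) :
    ((H ⊔ K : Subgroup G) : Set G) = H * K := by
  let T : Subgroup G :=
    { carrier := H * K
      mul_mem' := by
        intro a b ha hb
        have : a * b ∈ ((H : Set G) * K) * (H * K) := Set.mul_mem_mul ha hb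
        rw [mul_assoc, ← mul_assoc (K : Set G), ← show (H : Set G) * K = K * H from h] at this
        rwa [mul_assoc, coe_mul_coe, ← mul_assoc, coe_mul_coe] at this
      one_mem' := ⟨1, H.one_mem, 1, K.one_mem, mul_one 1⟩
      inv_mem' := by
        rintro _ ⟨a, ha, b, hb, rfl⟩
        rw [show (H : Set G) * K = K * H from h]
        exact ⟨b⁻¹, K.inv_mem hb, a⁻¹, H.inv_mem ha, (mul_inv_rev a b).symm⟩ }
  refine Set.Subset.antisymm (?_ : ((H ⊔ K : Subgroup G) : Set G) ⊆ T) ?_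
  · exact sup_le (c := T) (fun x hx => ⟨x, hx, 1, K.one_mem, mul_one x⟩)
      (fun x hx => ⟨1, H.one_mem, x, hx, one_mul x⟩)
  · rintro _ ⟨a, ha, b, hb, rfl⟩
    exact mul_mem_sup ha hb

theorem Subgroup.permutesWith_of_subset {H K : Subgroup G}
    (h : ∀ x ∈ K, ∀ y ∈ H, x * y ∈ (H : Set G) * K) : H.PermutesWith K := by
  refine Set.Subset.antisymm ?_ ?_
  · rintro _ ⟨a, ha, b, hb, rfl⟩
    obtain ⟨c, hc, d, hd, e⟩ := h b⁻¹ (K.inv_mem hb) a⁻¹ (H.inv_mem ha)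
    refine ⟨d⁻¹, K.inv_mem hd, c⁻¹, H.inv_mem hc, ?_⟩
    have e' : c * d = b⁻¹ * a⁻¹ := e
    change d⁻¹ * c⁻¹ = a * b
    rw [← mul_inv_rev, e', mul_inv_rev, inv_inv, inv_inv]
  · rintro _ ⟨a, ha, b, hb, rfl⟩
    exact h a ha b hb

theorem Subgroup.PermutesWith.of_normal_right (H K : Subgroup G) [K.Normal] : H.PermutesWith K :=
  set_mul_normal_comm (H : Set G) K

theorem Subgroup.PermutesWith.of_normal_left (H K : Subgroup G) [H.Normal] : H.PermutesWith K :=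
  (Subgroup.PermutesWith.of_normal_right K H).symm

theorem Subgroup.PermutesWith.map {G' : Type*} [Group G'] (f : G →* G') {H K : Subgroup G}
    (h : H.PermutesWith K) : (H.map f).PermutesWith (K.map f) := by
  unfold Subgroup.PermutesWith at *
  rw [coe_map, coe_map, ← Set.image_mul, ← Set.image_mul, h]

/-- If `H ≤ K`, `K` is a `p`-group normalised by the `q`-group `Q`, and `H` permutes with `Q`, then
`Q` normalises `H`. -/
theorem Subgroup.PermutesWith.conj_mem {p q : ℕ} [Fact p.Prime] [Fact q.Prime] (hpq : p ≠ q)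
    {H K Q : Subgroup G} (hK : IsPGroup p K) (hQ : IsPGroup q Q) (hHK : H ≤ K)
    (hQK : Q ≤ normalizer (K : Set G)) (h : H.PermutesWith Q) {x y : G} (hx : x ∈ Q) (hy : y ∈ H) :
    x * y * x⁻¹ ∈ H := by
  have hm : x * y ∈ (H : Set G) * Q := by
    rw [show (H : Set G) * Q = Q * H from h]
    exact Set.mul_mem_mul hx hy
  obtain ⟨a, ha, b, hb, e⟩ := hm
  have e : a * b = x * y := e
  have h1 : x * y * x⁻¹ ∈ K := (mem_normalizer_iff.mp (hQK hx) y).mp (hHK hy)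
  -- This element lies in Q by its left side and in K by its right side, and Q ⊓ K is trivial.
  have h2 : b * x⁻¹ = a⁻¹ * (x * y * x⁻¹) := by rw [← e]; group
  have h3 : b * x⁻¹ = 1 := disjoint_def.mp (IsPGroup.disjoint_of_ne p q hpq K Q hK hQ)
    (h2 ▸ K.mul_mem (K.inv_mem (hHK ha)) h1) (Q.mul_mem hb (Q.inv_mem hx))
  rw [← e, mul_assoc, h3, mul_one]
  exact ha

theorem Subgroup.relIndex_eq_index_of_isSupplement {H K : Subgroup G} (h : H.IsSupplement K) :
    K.relIndex H = K.index := by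
  have : MulAction.IsPretransitive H (G ⧸ K) := by
    refine (MulAction.isPretransitive_iff_base (QuotientGroup.mk (1 : G) : G ⧸ K)).mpr fun y => ?_
    obtain ⟨g, rfl⟩ := QuotientGroup.mk_surjective y
    obtain ⟨a, ha, b, hb, e⟩ : g ∈ (H : Set G) * K := by rw [h]; trivial
    refine ⟨⟨a, ha⟩, QuotientGroup.eq.mpr ?_⟩
    have e : a * b = g := e
    rw [← e]
    simpa using hb
  have hst : MulAction.stabilizer H (QuotientGroup.mk 1 : G ⧸ K) = K.subgroupOf H := by
    ext a
    rw [MulAction.mem_stabilizer_iff, mem_subgroupOf]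
    change (QuotientGroup.mk ((a : G) * 1) : G ⧸ K) = _ ↔ _
    rw [eq_comm, QuotientGroup.eq]
    simp
  rw [relIndex, ← hst, MulAction.index_stabilizer_of_transitive, index_eq_card]

/-- The index of K equals |H : H ⊓ K|, a power of p. Hence K contains Sylow q-subgroups of G. -/
theorem Subgroup.not_dvd_index_of_isSupplement [Finite G] {H K : Subgroup G} (h : H.IsSupplement K)
    {p q : ℕ} [hp : Fact p.Prime] [hq : Fact q.Prime] (hpq : p ≠ q) (hH : IsPGroup p H) :
    ¬ q ∣ K.index := by
  rw [← relIndex_eq_index_of_isSupplement h]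
  intro hd
  obtain ⟨n, hn⟩ := IsPGroup.iff_card.mp hH
  have := hq.out.dvd_of_dvd_pow (hn ▸ hd.trans (K.relIndex_dvd_card H))
  exact hpq ((Nat.prime_dvd_prime_iff_eq hq.out hp.out).mp this).symm

theorem Sylow.exists_le_of_not_dvd_index [Finite G] {q : ℕ} [hq : Fact q.Prime] {K : Subgroup G}
    (h : ¬ q ∣ K.index) (Q : Sylow q K) :
    ∃ R : Sylow q G, (R : Subgroup G) = (Q : Subgroup K).map K.subtype :=
  ⟨(Q.2.map K.subtype).toSylow (by
    rw [Subgroup.index_map_subtype]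
    exact hq.out.not_dvd_mul Q.not_dvd_index h), rfl⟩

theorem IsPGroup.le_of_normal_of_not_dvd_index [Finite G] {q : ℕ} [Fact q.Prime] {K N : Subgroup G}
    [N.Normal] (hN : IsPGroup q N) (h : ¬ q ∣ K.index) : N ≤ K := by
  obtain ⟨R, hR⟩ := Sylow.exists_le_of_not_dvd_index h (default : Sylow q K)
  exact (hN.le_sylow_of_normal R).trans (hR ▸ Subgroup.map_subtype_le _)

/-- In the group HQ the index of H is a power of q, so H contains a Sylow r-subgroup of HQ, and with
it the normal r-subgroup ⟨c⟩. -/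
theorem Subgroup.PermutesWith.mem_of_mem_mul [Finite G] {H Q : Subgroup G} (h : H.PermutesWith Q)
    {q r k : ℕ} [Fact q.Prime] [Fact r.Prime] (hqr : q ≠ r) (hQ : IsPGroup q Q) {c : G}
    (hc : orderOf c = r ^ k) (hcn : ∀ g, g * c * g⁻¹ ∈ zpowers c) (hm : c ∈ (H : Set G) * Q) :
    c ∈ H := by
  have hT := h.coe_sup
  set T := H ⊔ Q with hTdef
  have hcT : c ∈ T := by rw [← SetLike.mem_coe, hT]; exact hm
  have hs : (Q.subgroupOf T).IsSupplement (H.subgroupOf T) := by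
    refine Set.eq_univ_of_forall fun t => ?_
    have ht : (t : G) ∈ (Q : Set G) * H := by
      rw [← show (H : Set G) * Q = Q * H from h, ← hT]; exact t.2
    obtain ⟨a, ha, b, hb, e⟩ := ht
    exact ⟨⟨a, le_sup_right (a := H) ha⟩, ha, ⟨b, le_sup_left (b := Q) hb⟩, hb, Subtype.ext e⟩
  have hnd := not_dvd_index_of_isSupplement hs hqr (hQ.comap_subtype)
  have hord : orderOf (⟨c, hcT⟩ : T) = r ^ k := by rw [Subgroup.orderOf_mk, hc]
  have hN : (zpowers (⟨c, hcT⟩ : T)).Normal := by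
    refine ⟨fun n hn g => ?_⟩
    obtain ⟨j, rfl⟩ := mem_zpowers_iff.mp hn
    rw [← conj_zpow]
    obtain ⟨i, hi⟩ := mem_zpowers_iff.mp (hcn g)
    refine zpow_mem ?_ j
    exact mem_zpowers_iff.mpr ⟨i, Subtype.ext (by simpa using hi)⟩
  have hp : IsPGroup r (zpowers (⟨c, hcT⟩ : T)) :=
    IsPGroup.of_card (n := k) (by rw [Nat.card_zpowers, hord])
  exact hp.le_of_normal_of_not_dvd_index hnd (mem_zpowers _)

end Permute

/-- Every element of order prime to `p` that normalises a `p`-subgroup normalises all subgroups of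
that `p`-subgroup. -/
def HasLocalPowerAction (G : Type*) [Group G] : Prop :=
  ∀ p : ℕ, p.Prime → ∀ K : Subgroup G, IsPGroup p K → ∀ x ∈ Subgroup.normalizer (K : Set G),
    (orderOf x).Coprime p → ∀ k ∈ K, x * k * x⁻¹ ∈ Subgroup.zpowers k

/-- `L` is an abelian normal Hall subgroup, all of whose subgroups are normal in `G`, with nilpotent
quotient (expressed by the commutators of elements of coprime orders). -/
structure Subgroup.IsPowerHall {G : Type*} [Group G] (L : Subgroup G) : Prop where
  normal : L.Normal
  coprime : (Nat.card L).Coprime L.index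
  comm : ∀ a ∈ L, ∀ b ∈ L, a * b = b * a
  conj_mem : ∀ a ∈ L, ∀ g, g * a * g⁻¹ ∈ Subgroup.zpowers a
  commutator_mem : ∀ x y : G, (orderOf x).Coprime (orderOf y) → x * y * x⁻¹ * y⁻¹ ∈ L

/-! ### S-permutability in the presence of a power Hall subgroup -/

namespace Subgroup

variable {G : Type*} [Group G]

theorem mem_of_coprime_orderOf_index {L : Subgroup G} [L.Normal] {x : G}
    (h : (orderOf x).Coprime L.index) : x ∈ L := by
  rw [← QuotientGroup.eq_one_iff, ← orderOf_eq_one_iff (G := G ⧸ L)]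
  refine Nat.eq_one_of_dvd_coprimes h (orderOf_map_dvd (QuotientGroup.mk' L) x) ?_
  exact L.index_eq_card ▸ _root_.orderOf_dvd_natCard (x : G ⧸ L)

namespace IsPowerHall

variable {L : Subgroup G}

theorem subgroupOf (hL : L.IsPowerHall) (K : Subgroup G) : (L.subgroupOf K).IsPowerHall where
  normal := have := hL.normal; inferInstance
  coprime := by
    have := hL.normal
    refine (hL.coprime.coprime_dvd_left ?_).coprime_dvd_right (relIndex_dvd_index_of_normal L K)
    exact card_comap_dvd_of_injective L K.subtype K.subtype_injective
  comm a ha b hb := Subtype.ext (hL.comm a ha b hb)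
  conj_mem a ha g := by
    obtain ⟨i, hi⟩ := mem_zpowers_iff.mp (hL.conj_mem a ha g)
    exact mem_zpowers_iff.mpr ⟨i, Subtype.ext (by simpa using hi)⟩
  commutator_mem x y h := hL.commutator_mem x y (by rwa [orderOf_coe, orderOf_coe])

theorem mem_of_orderOf_eq_prime_pow (hL : L.IsPowerHall) {p k : ℕ}
    (hpL : p ∣ Nat.card L) {x : G} (hx : orderOf x = p ^ k) : x ∈ L := by
  have := hL.normal
  refine mem_of_coprime_orderOf_index ?_
  rw [hx]
  exact (hL.coprime.coprime_dvd_left hpL).pow_left k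

theorem normal_of_le (hL : L.IsPowerHall) {D : Subgroup G} (hD : D ≤ L) : D.Normal :=
  ⟨fun a ha g => (zpowers_le.mpr ha) (hL.conj_mem a (hD ha) g)⟩

/-- If p divides |L|, all p-elements lie in L, where cyclic subgroups are normal in G. Otherwise x *
k * x⁻¹ * k⁻¹ lies in L ⊓ K = 1. -/
theorem hasLocalPowerAction [Finite G] (hL : L.IsPowerHall) : HasLocalPowerAction G := by
  intro p hp K hK x hx hxp k hk
  have := Fact.mk hp
  have := hL.normal
  obtain ⟨e, he⟩ := IsPGroup.iff_orderOf.mp hK ⟨k, hk⟩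
  rw [orderOf_mk] at he
  by_cases hpL : p ∣ Nat.card L
  · exact hL.conj_mem k (hL.mem_of_orderOf_eq_prime_pow hpL he) x
  · have h1 : x * k * x⁻¹ * k⁻¹ ∈ L := hL.commutator_mem x k (by rw [he]; exact hxp.pow_right e)
    have h2 : x * k * x⁻¹ * k⁻¹ ∈ K :=
      K.mul_mem ((mem_normalizer_iff.mp hx k).mp hk) (K.inv_mem hk)
    obtain ⟨n, hn⟩ := IsPGroup.iff_card.mp hK
    have hd : Disjoint L K := disjoint_of_coprime_natCard (by
      rw [hn]; exact ((hp.coprime_iff_not_dvd.mpr hpL).symm).pow_right n)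
    have h3 : x * k * x⁻¹ * k⁻¹ = 1 := disjoint_def.mp hd h1 h2
    rw [mul_inv_eq_one.mp h3]
    exact mem_zpowers k

/-- Half of the criterion "S-permutable iff normalised by L". For a q-element y of H outside L, the
commutator of l and y lies in L and in HQ for a Sylow q-subgroup Q containing l * y * l⁻¹. Its
primary parts generate normal subgroups of order prime to q, so they lie in H. -/
theorem le_normalizer_of_isSPermutable [Finite G] (hL : L.IsPowerHall) {H : Subgroup G}
    (hH : H.IsSPermutable) : L ≤ normalizer (H : Set G) := by
  have := hL.normal
  intro l hl
  refine mem_normalizer_fintype fun y hy => ?_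
  suffices H ≤ H.comap (MulAut.conj l).toMonoidHom from this hy
  refine le_of_forall_prime_pow_orderOf fun q k hq y hy hyo => ?_
  change l * y * l⁻¹ ∈ H
  have := Fact.mk hq
  by_cases hqL : q ∣ Nat.card L
  · rw [hL.comm l hl y (hL.mem_of_orderOf_eq_prime_pow hqL hyo), mul_inv_cancel_right]
    exact hy
  obtain ⟨Q, hQ⟩ := Sylow.exists_mem_of_orderOf_eq (q := q) (k := k) (x := l * y * l⁻¹)
    (by rw [← hyo]; exact orderOf_injective (MulAut.conj l).toMonoidHom (MulAut.conj l).injective y)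
  have hc : l * y * l⁻¹ * y⁻¹ ∈ L := by
    rw [mul_assoc, mul_assoc]
    exact L.mul_mem hl (by rw [← mul_assoc]; exact hL.normal.conj_mem _ (L.inv_mem hl) y)
  suffices l * y * l⁻¹ * y⁻¹ ∈ H by
    have h2 := H.mul_mem this hy
    rwa [inv_mul_cancel_right] at h2
  refine mem_of_forall_prime_pow_orderOf H _ fun r j hr c hcz hco => ?_
  have hcL : c ∈ L := (zpowers_le.mpr hc) hcz
  have hpm := hH q hq Q
  have hcT : c ∈ H ⊔ (Q : Subgroup G) := (zpowers_le.mpr (mul_mem (le_sup_right (a := H) hQ)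
    (le_sup_left (b := (Q : Subgroup G)) (H.inv_mem hy)))) hcz
  rw [← SetLike.mem_coe, hpm.coe_sup] at hcT
  by_cases hqr : q = r
  · have : orderOf c = 1 := Nat.eq_one_of_dvd_coprimes
      (((hq.coprime_iff_not_dvd.mpr hqL).pow_left j)) (by rw [hco, hqr]) (orderOf_dvd_natCard L hcL)
    rw [orderOf_eq_one_iff.mp this]
    exact H.one_mem
  · have := Fact.mk hr
    exact hpm.mem_of_mem_mul hqr Q.2 hco (hL.conj_mem c hcL) hcT

theorem sup_sylow_normal [Finite G] (hL : L.IsPowerHall) {q : ℕ} [Fact q.Prime] (Q : Sylow q G) :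
    ((Q : Subgroup G) ⊔ L).Normal := by
  have := hL.normal
  rw [← normalizer_eq_top_iff]
  refine Q.eq_top_of_le_of_coprime_mem (le_sup_left.trans le_normalizer) fun z hz => ?_
  suffices h : (Q : Subgroup G) ⊔ L ≤ ((Q : Subgroup G) ⊔ L).comap (MulAut.conj z).toMonoidHom from
    mem_normalizer_fintype fun n hn => h hn
  refine sup_le (fun x hx => ?_) (fun x hx => ?_)
  · change z * x * z⁻¹ ∈ (Q : Subgroup G) ⊔ L
    obtain ⟨e, he⟩ := IsPGroup.iff_orderOf.mp Q.2 ⟨x, hx⟩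
    rw [orderOf_mk] at he
    rw [← inv_mul_cancel_right (z * x * z⁻¹) x]
    exact mul_mem (le_sup_right (a := (Q : Subgroup G))
      (hL.commutator_mem z x (by rw [he]; exact hz.pow_right e))) (le_sup_left (b := L) hx)
  · exact le_sup_right (a := (Q : Subgroup G)) (this.conj_mem x hx z)

/-- Frattini argument for the normal subgroup QL: G = L · N(Q), so the Sylow q-subgroups are
conjugate under L. -/
theorem exists_conj_mem_sylow [Finite G] (hL : L.IsPowerHall) {q k : ℕ} [Fact q.Prime]
    (Q : Sylow q G) {y : G} (hy : orderOf y = q ^ k) : ∃ l ∈ L, l⁻¹ * y * l ∈ Q := by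
  have := hL.normal
  have := hL.sup_sylow_normal Q
  have htop : L ⊔ normalizer (Q : Set G) = ⊤ := by
    rw [eq_top_iff, ← Sylow.normalizer_sup_eq_top' Q (le_sup_left (b := L))]
    exact sup_le le_sup_right (sup_le (le_normalizer.trans le_sup_right) le_sup_left)
  obtain ⟨R, hR⟩ := Sylow.exists_mem_of_orderOf_eq hy
  obtain ⟨g, rfl⟩ := MulAction.exists_smul_eq G Q R
  obtain ⟨l, hl, n, hn, rfl⟩ := mem_sup_of_normal_left.mp (htop ▸ mem_top g)
  rw [mul_smul, Sylow.smul_eq_iff_mem_normalizer.mpr hn] at hR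
  refine ⟨l, hl, ?_⟩
  have := (mem_pointwise_smul_iff_inv_smul_mem (a := MulAut.conj l) (S := (Q : Subgroup G))).mp hR
  rw [← map_inv, MulAut.smul_def, MulAut.conj_apply, inv_inv] at this
  exact this

/-- Everything is corrected by elements of H ⊓ L, which is normal in G because all subgroups of L
are. -/
theorem mul_mem_mul_sylow [Finite G] (hL : L.IsPowerHall) {H : Subgroup G}
    (hH : L ≤ normalizer (H : Set G)) {q : ℕ} [hq : Fact q.Prime] (Q : Sylow q G)
    (hqL : ¬ q ∣ Nat.card L) {r k : ℕ} (hr : r.Prime) {x y : G} (hx : x ∈ Q) (hy : y ∈ H)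
    (hyo : orderOf y = r ^ k) : x * y ∈ (H : Set G) * (Q : Subgroup G) := by
  have := hL.normal
  have hDn : (H ⊓ L).Normal := hL.normal_of_le inf_le_right
  by_cases hrL : r ∣ Nat.card L
  · exact ⟨x * y * x⁻¹, zpowers_le.mpr hy
      (hL.conj_mem y (hL.mem_of_orderOf_eq_prime_pow hrL hyo) x), x, hx, inv_mul_cancel_right _ _⟩
  -- An L-conjugate of y lies in H and in Q, and differs from y by a factor in H ⊓ L.
  by_cases hrq : r = q
  · subst hrq
    obtain ⟨l, hl, hz⟩ := hL.exists_conj_mem_sylow Q hyo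
    have hzH : l⁻¹ * y * l ∈ H := (mem_normalizer_iff''.mp (hH hl) y).mp hy
    have hc : y * (l⁻¹ * y * l)⁻¹ ∈ H ⊓ L := by
      refine mem_inf.mpr ⟨H.mul_mem hy (H.inv_mem hzH), ?_⟩
      rw [show y * (l⁻¹ * y * l)⁻¹ = (y * l⁻¹ * y⁻¹) * l by group]
      exact L.mul_mem (this.conj_mem _ (L.inv_mem hl) y) hl
    refine ⟨x * (y * (l⁻¹ * y * l)⁻¹) * x⁻¹, (hDn.conj_mem _ hc x).1, x * (l⁻¹ * y * l),
      mul_mem hx hz, ?_⟩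
    group
  · obtain ⟨e, he⟩ := IsPGroup.iff_orderOf.mp Q.2 ⟨x, hx⟩
    rw [orderOf_mk] at he
    have ht : x * y * x⁻¹ * y⁻¹ ∈ L := hL.commutator_mem x y (by
      rw [he, hyo]; exact Nat.Coprime.pow _ _ ((Nat.coprime_primes hq.out hr).mpr (Ne.symm hrq)))
    set t := x * y * x⁻¹ * y⁻¹ with htdef
    suffices htH : t ∈ H from ⟨t * y, H.mul_mem htH hy, x, hx, by simp [htdef]⟩
    have hcm : t * y * t⁻¹ * y⁻¹ ∈ H ⊓ L := by
      refine mem_inf.mpr ⟨H.mul_mem ((mem_normalizer_iff.mp (hH ht) y).mp hy) (H.inv_mem hy), ?_⟩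
      rw [show t * y * t⁻¹ * y⁻¹ = t * (y * t⁻¹ * y⁻¹) by group]
      exact L.mul_mem ht (this.conj_mem _ (L.inv_mem ht) y)
    -- Modulo H ⊓ L the commutator t commutes with y. Since t * y is conjugate to y, t ^ r ^ k lies
    -- in H ⊓ L; the order of t divides |L|, which is prime to r, so t itself does.
    have hcomm : Commute (t : G ⧸ H ⊓ L) (y : G ⧸ H ⊓ L) := by
      have h1 := (QuotientGroup.eq_one_iff _).mpr hcm
      rw [QuotientGroup.mk_mul, QuotientGroup.mk_mul, QuotientGroup.mk_mul, QuotientGroup.mk_inv,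
        QuotientGroup.mk_inv, mul_inv_eq_one, mul_inv_eq_iff_eq_mul] at h1
      exact h1
    have hty : (t * y) ^ r ^ k = 1 := by
      rw [show t * y = x * y * x⁻¹ by simp [htdef], conj_pow, ← hyo, pow_orderOf_eq_one]
      simp
    have htp : t ^ r ^ k ∈ H ⊓ L := by
      rw [← QuotientGroup.eq_one_iff]
      have h2 := congrArg (fun z : G => (z : G ⧸ H ⊓ L)) hty
      simp only [QuotientGroup.mk_pow, QuotientGroup.mk_mul, QuotientGroup.mk_one] at h2
      rw [hcomm.mul_pow, ← QuotientGroup.mk_pow _ y, ← hyo, pow_orderOf_eq_one, QuotientGroup.mk_one,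
        mul_one, hyo] at h2
      rw [QuotientGroup.mk_pow]
      exact h2
    refine ((H ⊓ L).mem_of_pow_mem_of_coprime
      ((hr.coprime_iff_not_dvd.mpr hrL).pow_left k) htp ?_).1
    rw [show t ^ Nat.card L = 1 from orderOf_dvd_iff_pow_eq_one.mp (orderOf_dvd_natCard L ht)]
    exact one_mem _

theorem isSPermutable_of_le_normalizer [Finite G] (hL : L.IsPowerHall) {H : Subgroup G}
    (hH : L ≤ normalizer (H : Set G)) : H.IsSPermutable := by
  intro q hq Q
  have := Fact.mk hq
  by_cases hqL : q ∣ Nat.card L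
  · have : (Q : Subgroup G).Normal := hL.normal_of_le fun x hx => by
      obtain ⟨e, he⟩ := IsPGroup.iff_orderOf.mp Q.2 ⟨x, hx⟩
      rw [orderOf_mk] at he
      exact hL.mem_of_orderOf_eq_prime_pow hqL he
    exact PermutesWith.of_normal_right H _
  -- H is generated by its elements of prime power order, which are moved past Q one at a time.
  let s : Set G := {y | y ∈ H ∧ ∃ r k : ℕ, r.Prime ∧ orderOf y = r ^ k}
  have hs : H ≤ closure s := le_of_forall_prime_pow_orderOf fun r k hr y hy hyo =>
    subset_closure ⟨hy, r, k, hr, hyo⟩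
  have hstep : ∀ h ∈ H, ∀ y ∈ s, (∀ x ∈ Q, x * h ∈ (H : Set G) * (Q : Subgroup G)) →
      ∀ x ∈ Q, x * (h * y) ∈ (H : Set G) * (Q : Subgroup G) := by
    rintro h hh y ⟨hy, r, k, hr, hyo⟩ ih x hx
    obtain ⟨a, ha, b, hb, e⟩ := ih x hx
    obtain ⟨c, hc, d, hd, e'⟩ := hL.mul_mem_mul_sylow hH Q hqL hr hb hy hyo
    refine ⟨a * c, H.mul_mem ha hc, d, hd, ?_⟩
    have e : a * b = x * h := e
    have e' : c * d = b * y := e'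
    change a * c * d = x * (h * y)
    rw [mul_assoc, e', ← mul_assoc, e, mul_assoc]
  have hsH : closure s ≤ H := (closure_le H).mpr fun y hy => hy.1
  refine permutesWith_of_subset fun x hx y hy => ?_
  revert x
  refine closure_induction_right (p := fun h _ => ∀ x ∈ Q, x * h ∈ (H : Set G) * (Q : Subgroup G))
    ?_ ?_ ?_ (hs hy)
  · exact fun x hx => ⟨1, H.one_mem, x, hx, by simp⟩
  · exact fun h hh y hy ih => hstep h (hsH hh) y hy ih
  · rintro h hh y ⟨hy, r, k, hr, hyo⟩ ih
    exact hstep h (hsH hh) y⁻¹ ⟨H.inv_mem hy, r, k, hr, by rwa [orderOf_inv]⟩ ih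

/-- L normalises K and L ⊓ K normalises H; it remains to treat l in L outside K. Such an l of prime
power order commutes with each prime power element y of H: otherwise y acts nontrivially and
coprimely on ⟨l⟩, so l is a power of the commutator of y and l, which lies in K. -/
theorem isPSTGroup [Finite G] (hL : L.IsPowerHall) : IsPSTGroup G := by
  intro H K hHK hH hK
  have hLK := hL.le_normalizer_of_isSPermutable hK
  have hLKH := (hL.subgroupOf K).le_normalizer_of_isSPermutable hH
  refine hL.isSPermutable_of_le_normalizer ?_
  refine le_of_forall_prime_pow_orderOf fun p k hp l hl hlo => ?_
  have := Fact.mk hp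
  refine mem_normalizer_fintype fun y hy => ?_
  suffices H ≤ H.comap (MulAut.conj l).toMonoidHom from this hy
  refine le_of_forall_prime_pow_orderOf fun q e hq y hy hyo => ?_
  change l * y * l⁻¹ ∈ H
  by_cases hlK : l ∈ K
  · have := (mem_normalizer_iff.mp (hLKH (show (⟨l, hlK⟩ : K) ∈ L.subgroupOf K from hl))
      ⟨y, hHK hy⟩).mp hy
    exact this
  suffices hcomm : y * l = l * y by
    rw [← hcomm, mul_inv_cancel_right]; exact hy
  by_cases hqL : q ∣ Nat.card L
  · exact hL.comm y (hL.mem_of_orderOf_eq_prime_pow hqL hyo) l hl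
  by_cases hl1 : l = 1
  · rw [hl1, mul_one, one_mul]
  have hpL : p ∣ Nat.card L := by
    refine dvd_trans ?_ (orderOf_dvd_natCard L hl)
    rw [hlo]
    refine dvd_pow_self p fun hk => hl1 ?_
    rw [hk, pow_zero] at hlo
    exact orderOf_eq_one_iff.mp hlo
  have hqp : q ≠ p := fun h => hqL (h ▸ hpL)
  have hz : IsPGroup p (zpowers l) := IsPGroup.of_card (n := k) (by rw [Nat.card_zpowers, hlo])
  have hconj : ∀ c ∈ zpowers l, y * c * y⁻¹ ∈ zpowers c := fun c hc =>
    hL.conj_mem c (zpowers_le.mpr hl hc) y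
  rcases hz.commute_or_comm_of_conj_mem_zpowers (x := y)
    (mem_normalizer_fintype fun c hc => zpowers_le.mpr hc (hconj c hc))
    (by rw [hyo]; exact Nat.Coprime.pow_left e ((Nat.coprime_primes hq hp).mpr hqp)) hconj
    with h | ⟨-, h⟩
  · exact h l (mem_zpowers l)
  · refine absurd (zpowers_le.mpr ?_ (h l (mem_zpowers l))) hlK
    rw [show y * l * y⁻¹ * l⁻¹ = y * (l * y⁻¹ * l⁻¹) by group]
    exact K.mul_mem (hHK hy) ((mem_normalizer_iff.mp (hLK hl) _).mp (K.inv_mem (hHK hy)))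

end IsPowerHall
end Subgroup

/-! ### Control of fusion and solvability -/

section Fusion

variable {G : Type*} [Group G]

theorem IsPGroup.exists_mem_normalizer_of_lt [Finite G] {p : ℕ} [Fact p.Prime] {D P : Subgroup G}
    (hP : IsPGroup p P) (h : D < P) : ∃ g ∈ P, g ∈ Subgroup.normalizer (D : Set G) ∧ g ∉ D := by
  have hn : Group.IsNilpotent P := hP.isNilpotent
  have hlt : D.subgroupOf P < ⊤ := by
    rw [lt_top_iff_ne_top, ne_eq, Subgroup.subgroupOf_eq_top]
    exact h.not_ge
  obtain ⟨g, hg, hgD⟩ := SetLike.exists_of_lt (Group.normalizerCondition_of_isNilpotent _ hlt)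
  refine ⟨g, g.2, Subgroup.mem_normalizer_iff.mpr fun x => ?_, hgD⟩
  constructor
  · intro hx
    exact (Subgroup.mem_normalizer_iff.mp hg ⟨x, h.le hx⟩).mp hx
  · intro hx
    have hxP : x ∈ P := by
      have := P.mul_mem (P.mul_mem (P.inv_mem g.2) (h.le hx)) g.2
      simpa [mul_assoc] using this
    exact (Subgroup.mem_normalizer_iff.mp hg ⟨x, hxP⟩).mpr hx

/-- Elements of order prime to `p` in the normaliser of a `p`-subgroup centralise it. -/
def HasCentralLocalAction (p : ℕ) (G : Type*) [Group G] : Prop :=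
  ∀ K : Subgroup G, IsPGroup p K → ∀ x ∈ Subgroup.normalizer (K : Set G),
    (orderOf x).Coprime p → ∀ k ∈ K, x * k = k * x

namespace HasCentralLocalAction

variable [Finite G] {p : ℕ} [Fact p.Prime]

/-- The centraliser of D contains all p'-elements of the normaliser, so together with a Sylow
p-subgroup it is the whole normaliser. -/
theorem exists_centralizer_mul (h : HasCentralLocalAction p G) {D : Subgroup G} (hD : IsPGroup p D)
    (S : Sylow p (Subgroup.normalizer (D : Set G))) (n : Subgroup.normalizer (D : Set G)) :
    ∃ c : Subgroup.normalizer (D : Set G), (c : G) ∈ Subgroup.centralizer (D : Set G) ∧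
      ∃ s ∈ S, c * s = n := by
  have hC : ((Subgroup.centralizer (D : Set G)).subgroupOf
    (Subgroup.normalizer (D : Set G))).Normal := inferInstance
  have htop : (Subgroup.centralizer (D : Set G)).subgroupOf
      (Subgroup.normalizer (D : Set G)) ⊔ (S : Subgroup (Subgroup.normalizer (D : Set G))) = ⊤ := by
    refine S.eq_top_of_le_of_coprime_mem le_sup_right fun x hx => Subgroup.mem_sup_left ?_
    rw [Subgroup.mem_subgroupOf, Subgroup.mem_centralizer_iff]
    exact fun k hk => (h D hD x x.2 (by rwa [Subgroup.orderOf_coe]) k hk).symm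
  obtain ⟨c, hc, s, hs, e⟩ := Subgroup.mem_sup_of_normal_left.mp (htop ▸ Subgroup.mem_top n)
  exact ⟨c, hc, s, hs, e⟩

/-- Induction towards larger intersections. With D = P ⊓ Q, Sylow subgroups S and T of N(D)
containing N_P(D) and N_Q(D) are conjugate by some c centralising D. For a Sylow subgroup R of G
above S, both P ⊓ R and cR ⊓ Q exceed D, because normalisers grow in p-groups. -/
theorem exists_centralizer_smul_eq (h : HasCentralLocalAction p G) (P Q : Sylow p G) :
    ∃ c ∈ Subgroup.centralizer ((P ⊓ Q : Subgroup G) : Set G), c • P = Q := by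
  suffices H : ∀ n : ℕ, ∀ P Q : Sylow p G,
      Nat.card G - Nat.card (P ⊓ Q : Subgroup G) = n →
      ∃ c ∈ Subgroup.centralizer ((P ⊓ Q : Subgroup G) : Set G), c • P = Q from H _ P Q rfl
  intro n
  induction n using Nat.strong_induction_on with
  | _ n ih =>
  intro P Q hn
  have ih' : ∀ P' Q' : Sylow p G, (P ⊓ Q : Subgroup G) < (P' ⊓ Q' : Subgroup G) →
      ∃ c ∈ Subgroup.centralizer ((P ⊓ Q : Subgroup G) : Set G), c • P' = Q' := by
    intro P' Q' hlt
    have hc1 : Nat.card (P ⊓ Q : Subgroup G) < Nat.card (P' ⊓ Q' : Subgroup G) :=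
      Set.Finite.card_lt_card (Set.toFinite _) hlt
    have hc2 := Subgroup.card_le_card_group (P' ⊓ Q' : Subgroup G)
    obtain ⟨c, hc, e⟩ := ih _ (by lia) P' Q' rfl
    exact ⟨c, Subgroup.centralizer_le hlt.le hc, e⟩
  by_cases hPQ : (P : Subgroup G) ≤ Q
  · exact ⟨1, one_mem _, by rw [one_smul]; exact Sylow.ext (P.3 Q.2 hPQ).symm⟩
  by_cases hQP : (Q : Subgroup G) ≤ P
  · exact absurd (Q.3 P.2 hQP).le hPQ
  set D : Subgroup G := P ⊓ Q with hDdef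
  have hDp : IsPGroup p D := P.2.to_le inf_le_left
  obtain ⟨g, hgP, hgN, hgD⟩ := P.2.exists_mem_normalizer_of_lt
    (lt_of_le_of_ne inf_le_left (fun e => hPQ (inf_eq_left.mp e)) : D < P)
  obtain ⟨k, hkQ, hkN, hkD⟩ := Q.2.exists_mem_normalizer_of_lt
    (lt_of_le_of_ne inf_le_right (fun e => hQP (inf_eq_right.mp e)) : D < Q)
  obtain ⟨S, hS⟩ := (P.2.comap_subtype (K := Subgroup.normalizer (D : Set G))).exists_le_sylow
  obtain ⟨T, hT⟩ := (Q.2.comap_subtype (K := Subgroup.normalizer (D : Set G))).exists_le_sylow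
  obtain ⟨m, hm⟩ := MulAction.exists_smul_eq (Subgroup.normalizer (D : Set G)) S T
  obtain ⟨c, hc, s, hs, rfl⟩ := h.exists_centralizer_mul hDp S m
  rw [mul_smul, Sylow.smul_eq_iff_mem_normalizer.mpr (Subgroup.le_normalizer hs)] at hm
  obtain ⟨R, hR⟩ := (S.2.map (Subgroup.normalizer (D : Set G)).subtype).exists_le_sylow
  have hSR : ∀ z : Subgroup.normalizer (D : Set G), z ∈ S → (z : G) ∈ R := fun z hz =>
    hR (Subgroup.mem_map_of_mem _ hz)
  have hTR : ∀ z : Subgroup.normalizer (D : Set G), z ∈ T → (z : G) ∈ ((c : G) • R : Sylow p G) := by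
    intro z hz
    rw [← hm] at hz
    have hz' := (Subgroup.mem_pointwise_smul_iff_inv_smul_mem (a := MulAut.conj c)
      (S := (S : Subgroup (Subgroup.normalizer (D : Set G))))).mp hz
    exact (Subgroup.mem_pointwise_smul_iff_inv_smul_mem (a := MulAut.conj (c : G))
      (S := (R : Subgroup G))).mpr (hSR _ hz')
  have hDN : D ≤ Subgroup.normalizer (D : Set G) := Subgroup.le_normalizer
  obtain ⟨x, hx, hxe⟩ := ih' P R (lt_of_le_of_ne
    (le_inf inf_le_left fun z hz => hSR ⟨z, hDN hz⟩ (hS (inf_le_left (a := (P : Subgroup G)) hz)))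
    fun e => hgD (e ▸ ⟨hgP, hSR ⟨g, hgN⟩ (hS hgP)⟩))
  obtain ⟨y, hy, hye⟩ := ih' ((c : G) • R) Q (lt_of_le_of_ne
    (le_inf (fun z hz => hTR ⟨z, hDN hz⟩ (hT (inf_le_right (b := (Q : Subgroup G)) hz)))
      inf_le_right)
    fun e => hkD (e ▸ ⟨hTR ⟨k, hkN⟩ (hT hkQ), hkQ⟩))
  exact ⟨y * (c * x), mul_mem hy (mul_mem hc hx), by rw [mul_smul, mul_smul, hxe, hye]⟩

/-- Both P and its conjugate by g⁻¹ contain x, so some c centralising x carries one to the other.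
Then g * c lies in N(P) = C(P)P. -/
theorem exists_mem_conj_eq (h : HasCentralLocalAction p G) (P : Sylow p G) {x g : G} (hx : x ∈ P)
    (hg : g * x * g⁻¹ ∈ P) : ∃ u ∈ P, g * x * g⁻¹ = u * x * u⁻¹ := by
  obtain ⟨c, hc, hce⟩ := h.exists_centralizer_smul_eq P (g⁻¹ • P)
  have hxc : x * c = c * x := Subgroup.mem_centralizer_iff.mp hc x ⟨hx, by
    refine (Subgroup.mem_pointwise_smul_iff_inv_smul_mem (a := MulAut.conj g⁻¹)
      (S := (P : Subgroup G))).mpr ?_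
    rw [← map_inv, inv_inv, MulAut.smul_def, MulAut.conj_apply]
    exact hg⟩
  have hn : g * c ∈ Subgroup.normalizer (P : Set G) := by
    rw [← Sylow.smul_eq_iff_mem_normalizer, mul_smul, hce, smul_inv_smul]
  obtain ⟨d, hd, u, hu, e⟩ := h.exists_centralizer_mul P.2 (P.subtype Subgroup.le_normalizer)
    ⟨g * c, hn⟩
  have e : (d : G) * u = g * c := congrArg Subtype.val e
  have huP : (u : G) ∈ P := hu
  refine ⟨u, huP, ?_⟩
  have hdc := Subgroup.mem_centralizer_iff.mp hd ((u : G) * x * (u : G)⁻¹)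
    (mul_mem (mul_mem huP hx) (inv_mem huP))
  calc g * x * g⁻¹ = (g * c) * x * (g * c)⁻¹ := by
        rw [mul_assoc g c x, ← hxc]; group
    _ = ((d : G) * ((u : G) * x * (u : G)⁻¹)) * (d : G)⁻¹ := by rw [← e]; group
    _ = (u : G) * x * (u : G)⁻¹ := by rw [← hdc, mul_inv_cancel_right]

/-- By control of fusion the focal subgroup of P is contained in the derived subgroup of P, which is
proper in the nontrivial p-group P. -/
theorem commutator_ne_top (h : HasCentralLocalAction p G) (hp : p ∣ Nat.card G) :
    commutator G ≠ ⊤ := by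
  intro htop
  let P : Sylow p G := default
  have hf : (P : Subgroup G).focalSubgroup ≤ (commutator P).map (P : Subgroup G).subtype := by
    rw [Subgroup.focalSubgroup_def, Subgroup.closure_le]
    rintro _ ⟨hm, x, hx, u, rfl⟩
    have hu : u * x⁻¹ * u⁻¹ ∈ P := by
      have := mul_mem (inv_mem hx) hm
      rwa [commutatorElement_def, mul_assoc, mul_assoc, inv_mul_cancel_left, ← mul_assoc] at this
    obtain ⟨v, hv, e⟩ := h.exists_mem_conj_eq P (inv_mem hx) hu
    have e2 : ⁅x, u⁆ = ⁅x, v⁆ := by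
      rw [commutatorElement_def, commutatorElement_def, mul_assoc, mul_assoc, ← mul_assoc u, e]
      group
    rw [e2]
    exact ⟨⁅⟨x, hx⟩, ⟨v, hv⟩⁆, Subgroup.commutator_mem_commutator (Subgroup.mem_top _)
      (Subgroup.mem_top _), rfl⟩
  have hfe := Subgroup.commutator_inf_eq_focalSubgroup P
  rw [htop, top_inf_eq] at hfe
  have hnt : Nontrivial P :=
    (Subgroup.nontrivial_iff_ne_bot _).mpr (P.ne_bot_of_dvd_card hp)
  have hsol : Group.IsSolvable P := by
    have := P.2.isNilpotent
    infer_instance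
  refine (Group.IsSolvable.commutator_lt_top_of_nontrivial (G := P)).ne (top_le_iff.mp fun x _ => ?_)
  obtain ⟨y, hy, e⟩ := hf (hfe.le x.2)
  have e : y = x := Subtype.ext e
  rwa [← e]

end HasCentralLocalAction

namespace HasLocalPowerAction

theorem subgroup (h : HasLocalPowerAction G) (S : Subgroup G) : HasLocalPowerAction S := by
  intro p hp K hK x hx hxp k hk
  have hn : (x : G) ∈ Subgroup.normalizer ((K.map S.subtype : Subgroup G) : Set G) := by
    have := Subgroup.le_normalizer_map S.subtype (Subgroup.mem_map_of_mem S.subtype hx)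
    exact this
  obtain ⟨i, hi⟩ := Subgroup.mem_zpowers_iff.mp (h p hp (K.map S.subtype) (hK.map _) x hn
    (by rwa [Subgroup.orderOf_coe]) k (Subgroup.mem_map_of_mem _ hk))
  exact Subgroup.mem_zpowers_iff.mpr ⟨i, Subtype.ext (by simpa using hi)⟩

/-- The exponent by which x acts on k has, modulo p, an order dividing both p - 1 and the order of
x. These are coprime because p is the smallest prime divisor, so the exponent is 1 mod p. -/
theorem hasCentralLocalAction [Finite G] [Nontrivial G] (h : HasLocalPowerAction G) :
    HasCentralLocalAction (Nat.card G).minFac G := by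
  have hp : (Nat.card G).minFac.Prime := Nat.minFac_prime Finite.one_lt_card.ne'
  intro K hK x hx hxp k hk
  set p := (Nat.card G).minFac with hpdef
  have := Fact.mk hp
  by_cases hk1 : k = 1
  · rw [hk1, mul_one, one_mul]
  obtain ⟨m, hm⟩ := Subgroup.mem_zpowers_iff.mp (h p hp K hK x hx hxp k hk)
  have hφ : (MulAut.conj x) k = k ^ m := hm.symm
  have hpk : (p : ℤ) ∣ orderOf k := by
    have := hK.dvd_orderOf (g := ⟨k, hk⟩) (fun e => hk1 (congrArg Subtype.val e))
    rw [Subgroup.orderOf_mk] at this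
    exact_mod_cast this
  have hmn : (p : ℤ) ∣ m ^ orderOf x - 1 := by
    refine hpk.trans (orderOf_dvd_iff_zpow_eq_one.mpr ?_)
    rw [zpow_sub, ← (MulAut.conj x).pow_apply_eq_zpow hφ, ← map_pow, pow_orderOf_eq_one, map_one,
      zpow_one, MulAut.one_apply, mul_inv_cancel]
  have hz : ((m : ZMod p)) ^ orderOf x = 1 := by
    have := (ZMod.intCast_zmod_eq_zero_iff_dvd _ p).mpr hmn
    push_cast at this
    exact sub_eq_zero.mp this
  have hm0 : (m : ZMod p) ≠ 0 := by
    intro h0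
    rw [h0, zero_pow (orderOf_pos x).ne'] at hz
    exact zero_ne_one hz
  have hco : (orderOf x).Coprime (p - 1) := by
    refine Nat.coprime_of_dvd fun r hr hrx hrp => ?_
    have h1 : p ≤ r := Nat.minFac_le_of_dvd hr.two_le (hrx.trans (orderOf_dvd_natCard x))
    have h2 := Nat.le_of_dvd (by have := hp.two_le; lia) hrp
    have := hp.two_le
    lia
  have hm1 : (m : ZMod p) = 1 := orderOf_eq_one_iff.mp (Nat.eq_one_of_dvd_coprimes hco
    (orderOf_dvd_of_pow_eq_one hz) (orderOf_dvd_of_pow_eq_one (ZMod.pow_card_sub_one_eq_one hm0)))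
  have hd : (p : ℤ) ∣ m - 1 := by
    rw [← ZMod.intCast_zmod_eq_zero_iff_dvd]
    push_cast
    rw [hm1, sub_self]
  obtain ⟨e, he⟩ := hK ⟨k, hk⟩
  have := (MulAut.conj x).apply_eq_self_of_dvd_sub_one
    (hxp.coprime_dvd_left (orderOf_map_dvd _ _)) ⟨e, congrArg Subtype.val he⟩ hφ hd
  exact mul_inv_eq_iff_eq_mul.mp this

theorem isSolvable [Finite G] (h : HasLocalPowerAction G) : Group.IsSolvable G := by
  suffices H : ∀ n : ℕ, ∀ (S : Subgroup G), Nat.card S = n → Group.IsSolvable S by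
    have := H _ ⊤ rfl
    exact Group.isSolvable_of_surjective (f := (⊤ : Subgroup G).subtype)
      (by rw [← MonoidHom.range_eq_top, Subgroup.range_subtype])
  intro n
  induction n using Nat.strong_induction_on with
  | _ n ih =>
  intro S hn
  rcases subsingleton_or_nontrivial S with hs | hs
  · exact Group.isSolvable_of_comm fun a b => Subsingleton.elim _ _
  have hp : (Nat.card S).minFac.Prime := Nat.minFac_prime Finite.one_lt_card.ne'
  have := Fact.mk hp
  have hne := (h.subgroup S).hasCentralLocalAction.commutator_ne_top (Nat.minFac_dvd _)
  have hlt : Nat.card ((commutator S).map S.subtype) < n := by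
    rw [Subgroup.card_map_of_injective S.subtype_injective, ← hn]
    refine lt_of_le_of_ne (Subgroup.card_le_card_group _) fun e => hne ?_
    exact Subgroup.eq_top_of_card_eq _ e
  have hsol := ih _ hlt _ rfl
  have hsol' : Group.IsSolvable (commutator S) :=
    Group.isSolvable_of_surjective
      (f := ((commutator S).equivMapOfInjective S.subtype S.subtype_injective).symm.toMonoidHom)
      (MulEquiv.surjective _)
  refine (Group.isSolvable_iff_subgroup_quotient (commutator S)).mpr ⟨hsol', ?_⟩
  exact Group.isSolvable_of_comm fun a b => mul_comm (G := Abelianization S) a b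

end HasLocalPowerAction

end Fusion

/-- Every element of order prime to `p` normalises all subgroups of each normal `p`-subgroup. -/
def HasNormalPowerAction (G : Type*) [Group G] : Prop :=
  ∀ p : ℕ, p.Prime → ∀ K : Subgroup G, K.Normal → IsPGroup p K → ∀ x : G,
    (orderOf x).Coprime p → ∀ k ∈ K, x * k * x⁻¹ ∈ Subgroup.zpowers k

/-- Every homomorphic image of `G` satisfies `HasNormalPowerAction`. -/
def HasQuotientPowerAction (G : Type u) [Group G] : Prop :=
  ∀ (Q : Type u) [Group Q] (f : G →* Q), Function.Surjective f → HasNormalPowerAction Q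

/-- `G` is `p`-nilpotent: it has a normal `p`-complement. -/
def HasNormalComplement (p : ℕ) (G : Type*) [Group G] : Prop :=
  ∃ M : Subgroup G, M.Normal ∧ ¬ p ∣ Nat.card M ∧ ∃ n : ℕ, M.index = p ^ n

/-- `G` has a normal abelian Sylow `p`-subgroup all of whose subgroups are normal in `G`. -/
def HasPowerSylow (p : ℕ) (G : Type*) [Group G] : Prop :=
  ∃ P : Subgroup G, P.Normal ∧ IsPGroup p P ∧ ¬ p ∣ P.index ∧ (∀ a ∈ P, ∀ b ∈ P, a * b = b * a) ∧
    ∀ a ∈ P, ∀ g, g * a * g⁻¹ ∈ Subgroup.zpowers a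

theorem HasQuotientPowerAction.of_surjective {G G' : Type u} [Group G] [Group G']
    (h : HasQuotientPowerAction G) (f : G →* G') (hf : Function.Surjective f) :
    HasQuotientPowerAction G' := fun G'' _ g hg => h G'' (g.comp f) (hg.comp hf)

theorem HasQuotientPowerAction.hasNormalPowerAction {G : Type u} [Group G]
    (h : HasQuotientPowerAction G) : HasNormalPowerAction G :=
  h G (MonoidHom.id G) Function.surjective_id

/-! ### Normal complements, Sylow subgroups of power type, and the Hall subgroup -/

section

variable {G : Type*} [Group G]

theorem Commute.right_eq_one_of_coprime {b n : G} (h : Commute b n) {k j : ℕ} (hkj : k.Coprime j)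
    (hbn : (b * n) ^ k = 1) (hb : b ^ k = 1) (hn : n ^ j = 1) : n = 1 := by
  rw [h.mul_pow, hb, one_mul] at hbn
  exact Subgroup.mem_bot.mp ((⊥ : Subgroup G).mem_of_pow_mem_of_coprime hkj
    (Subgroup.mem_bot.mpr hbn) (Subgroup.mem_bot.mpr hn))

/-- The automorphisms induced on a cyclic normal subgroup commute. -/
theorem Subgroup.commutator_commute_of_isCyclic (N : Subgroup G) [N.Normal] [IsCyclic N] (x k : G)
    {n : G} (hn : n ∈ N) : (x * k * x⁻¹ * k⁻¹) * n = n * (x * k * x⁻¹ * k⁻¹) := by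
  have hpow : ∀ g : G, ∃ m : ℤ, ∀ n ∈ N, g * n * g⁻¹ = n ^ m := fun g => by
    obtain ⟨m, hm⟩ := MonoidHom.map_cyclic (MulAut.conjNormal (H := N) g).toMonoidHom
    refine ⟨m, fun n hn => ?_⟩
    have := congrArg Subtype.val (hm ⟨n, hn⟩)
    simpa using this
  obtain ⟨a, ha⟩ := hpow x
  obtain ⟨b, hb⟩ := hpow k
  have h1 : ∀ n ∈ N, x * (k * n * k⁻¹) * x⁻¹ = k * (x * n * x⁻¹) * k⁻¹ := fun n hn => by
    rw [hb n hn, ha n hn, ha _ (N.zpow_mem hn b), hb _ (N.zpow_mem hn a), ← zpow_mul, ← zpow_mul,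
      mul_comm]
  have hn' : (x⁻¹ * (k⁻¹ * n * k) * x) ∈ N := by
    have h2 : k⁻¹ * n * k ∈ N := by
      simpa using (inferInstance : N.Normal).conj_mem n hn k⁻¹
    simpa using (inferInstance : N.Normal).conj_mem _ h2 x⁻¹
  have h3 := h1 _ hn'
  have e1 : k * (x * (x⁻¹ * (k⁻¹ * n * k) * x) * x⁻¹) * k⁻¹ = n := by group
  rw [e1] at h3
  calc (x * k * x⁻¹ * k⁻¹) * n
      = (x * (k * (x⁻¹ * (k⁻¹ * n * k) * x) * k⁻¹) * x⁻¹) * (x * k * x⁻¹ * k⁻¹) := by group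
    _ = n * (x * k * x⁻¹ * k⁻¹) := by rw [h3]

/-- A central subgroup `N` of prime order `p` in a normal subgroup `E`, with index in `E` prime to
`p`, has a complement in `E` that is normal in `G`. -/
theorem Subgroup.exists_normal_complement_of_central {p : ℕ} (hp : p.Prime) {N E : Subgroup G}
    [N.Normal] (hE : E.Normal) (hNE : N ≤ E) (hN : Nat.card N = p) (hi : ¬ p ∣ N.relIndex E)
    (hc : ∀ n ∈ N, ∀ e ∈ E, n * e = e * n) :
    ∃ A : Subgroup G, A.Normal ∧ ¬ p ∣ Nat.card A ∧ N ⊔ A = E := by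
  have hcard : Nat.card (N.subgroupOf E) = p := by
    rw [← hN]; exact Nat.card_congr (subgroupOfEquivOfLe hNE).toEquiv
  obtain ⟨A, hA⟩ := exists_right_complement'_of_coprime (N := N.subgroupOf E)
    (by rw [hcard]; exact hp.coprime_iff_not_dvd.mpr hi)
  have hAc : Nat.card (A.map E.subtype) = N.relIndex E := by
    rw [card_map_of_injective E.subtype_injective]; exact hA.symm.index_eq_card.symm
  have hsup : N ⊔ A.map E.subtype = E := by
    have := congrArg (Subgroup.map E.subtype) hA.sup_eq_top
    rwa [map_sup, subgroupOf_map_subtype, inf_of_le_left hNE, ← MonoidHom.range_eq_map,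
      range_subtype] at this
  refine ⟨A.map E.subtype, ⟨fun a ha g => ?_⟩, hAc ▸ hi, hsup⟩
  have haE : a ∈ E := map_subtype_le A ha
  have hg : g * a * g⁻¹ ∈ N ⊔ A.map E.subtype := by
    rw [hsup]; exact hE.conj_mem a haE g
  obtain ⟨n, hn, b, hb, e⟩ := mem_sup_of_normal_left.mp hg
  have hbE : b ∈ E := map_subtype_le A hb
  have hpow : ∀ c ∈ A.map E.subtype, c ^ N.relIndex E = 1 := fun c hc =>
    orderOf_dvd_iff_pow_eq_one.mp (hAc ▸ Subgroup.orderOf_dvd_natCard _ hc)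
  have hn1 : n = 1 := by
    refine Commute.right_eq_one_of_coprime (b := b) (hc n hn b hbE).symm
      (hp.coprime_iff_not_dvd.mpr hi).symm ?_ (hpow b hb)
      (orderOf_dvd_iff_pow_eq_one.mp (hN ▸ Subgroup.orderOf_dvd_natCard _ hn))
    rw [← hc n hn b hbE, e, conj_pow, hpow a ha, mul_one, mul_inv_cancel]
  rw [← e, hn1, one_mul]
  exact hb

theorem HasNormalComplement.of_quotient {p : ℕ} (hp : p.Prime) {N : Subgroup G} [N.Normal]
    (hN : ¬ p ∣ Nat.card N) (h : HasNormalComplement p (G ⧸ N)) : HasNormalComplement p G := by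
  obtain ⟨M, hMn, hMc, n, hn⟩ := h
  refine ⟨M.comap (QuotientGroup.mk' N), inferInstance, ?_, n, ?_⟩
  · rw [show Nat.card (M.comap (QuotientGroup.mk' N)) = Nat.card N * Nat.card M from
      QuotientGroup.card_preimage_mk N M]
    exact hp.not_dvd_mul hN hMc
  · rw [M.index_comap_of_surjective (QuotientGroup.mk'_surjective N), hn]

/-- If `G` has no nontrivial normal subgroup of order prime to `p` and the quotient by a normal
subgroup of order `p` is `p`-nilpotent, then the centraliser of that subgroup is a `p`-group. -/
theorem HasNormalComplement.isPGroup_centralizer {p : ℕ} (hp : p.Prime) {N : Subgroup G} [N.Normal]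
    (hN : Nat.card N = p) (hO : ∀ A : Subgroup G, A.Normal → ¬ p ∣ Nat.card A → A = ⊥)
    (h : HasNormalComplement p (G ⧸ N)) : IsPGroup p (Subgroup.centralizer (N : Set G)) := by
  have := Fact.mk hp
  have hcyc : IsCyclic N := isCyclic_of_prime_card hN
  obtain ⟨M', hM'n, hM'c, n, hn⟩ := h
  set C := Subgroup.centralizer (N : Set G) with hC
  set M := M'.comap (QuotientGroup.mk' N) with hM
  have hMi : M.index = p ^ n := by
    rw [hM, M'.index_comap_of_surjective (QuotientGroup.mk'_surjective N), hn]
  have hNC : N ≤ C := fun x hx => Subgroup.mem_centralizer_iff.mpr fun y hy =>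
    congrArg Subtype.val ((IsCyclic.isMulCommutative (α := N)).is_comm.comm ⟨y, hy⟩ ⟨x, hx⟩)
  have hNM : N ≤ M := fun x hx => by
    change (x : G ⧸ N) ∈ M'
    rw [(QuotientGroup.eq_one_iff x).mpr hx]
    exact M'.one_mem
  have hi : ¬ p ∣ N.relIndex (C ⊓ M) := by
    have hk := Subgroup.relIndex_ker (C ⊓ M) (QuotientGroup.mk' N)
    rw [QuotientGroup.ker_mk'] at hk
    rw [hk]
    refine fun hd => hM'c (hd.trans (Subgroup.card_dvd_of_le ?_))
    exact (Subgroup.map_mono inf_le_right).trans (Subgroup.map_comap_le _ _)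
  obtain ⟨A, hA, hAc, hAs⟩ := Subgroup.exists_normal_complement_of_central hp
    (inferInstance : (C ⊓ M).Normal) (le_inf hNC hNM) hN hi
    (fun m hm e he => Subgroup.mem_centralizer_iff.mp he.1 m hm)
  -- Thus C ⊓ M = N; as M has index p ^ n, the p ^ n-th power of each element of C lies in N.
  rw [hO A hA hAc, sup_bot_eq] at hAs
  intro c
  have h1 : (c : G) ^ p ^ n ∈ N := by
    rw [hAs]
    exact ⟨pow_mem c.2 _, hMi ▸ M.pow_index_mem (c : G)⟩
  refine ⟨n + 1, Subtype.ext ?_⟩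
  have h2 : ((c : G) ^ p ^ n) ^ p = 1 :=
    orderOf_dvd_iff_pow_eq_one.mp ((Subgroup.orderOf_dvd_natCard _ h1).trans hN.dvd)
  rw [Subgroup.coe_pow, Subgroup.coe_one, pow_succ, pow_mul, h2]

variable [Finite G]

/-- A Sylow q-subgroup centralises some element of order q in M, and the q'-elements normalise the
subgroup it generates. -/
theorem HasNormalPowerAction.exists_prime_card_le_of_isPGroup (h : HasNormalPowerAction G)
    {q : ℕ} [hq : Fact q.Prime] {M : Subgroup G} [hMn : M.Normal] (hM : IsPGroup q M) (hM1 : M ≠ ⊥) :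
    ∃ N ≤ M, N.Normal ∧ Nat.card N = q := by
  let S : Sylow q G := default
  have hle : (S : Subgroup G) ≤ Subgroup.normalizer (M : Set G) := by
    rw [Subgroup.normalizer_eq_top_iff.mpr hMn]; exact le_top
  let _ : MulAction S M := MulAction.compHom M (Subgroup.inclusion hle)
  have hsmul : ∀ (s : S) (m : M), ((s • m : M) : G) = s * m * (s : G)⁻¹ := fun s m => rfl
  have hqM : q ∣ Nat.card M := hM.card_eq_or_dvd.resolve_left fun e => hM1 (Subgroup.card_eq_one.mp e)
  obtain ⟨z, hz, hz1⟩ := S.2.exists_fixed_point_of_prime_dvd_card_of_fixed_point M hqM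
    (a := 1) (fun s => Subtype.ext (by rw [hsmul]; simp))
  have hzo : q ∣ Nat.card (Subgroup.zpowers z) := by
    rw [Nat.card_zpowers]; exact hM.dvd_orderOf (Ne.symm hz1)
  obtain ⟨⟨w, hw⟩, hwo⟩ := exists_prime_orderOf_dvd_card' q hzo
  rw [Subgroup.orderOf_mk] at hwo
  have hcomm : ∀ s ∈ S, s * (w : G) * s⁻¹ = w := by
    obtain ⟨i, rfl⟩ := Subgroup.mem_zpowers_iff.mp hw
    intro s hs
    have := congrArg Subtype.val (hz ⟨s, hs⟩)
    rw [hsmul] at this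
    rw [Subgroup.coe_zpow, ← conj_zpow]
    exact congrArg (· ^ i) this
  refine ⟨Subgroup.zpowers (w : G), Subgroup.zpowers_le.mpr w.2, ?_, ?_⟩
  · rw [← Subgroup.normalizer_eq_top_iff]
    refine S.eq_top_of_le_of_coprime_mem (fun s hs => ?_) fun x hx => ?_
    · refine Subgroup.mem_normalizer_fintype fun n hn => ?_
      obtain ⟨i, rfl⟩ := Subgroup.mem_zpowers_iff.mp hn
      rw [← conj_zpow, hcomm s hs]
      exact Subgroup.zpow_mem_zpowers _ _
    · refine Subgroup.mem_normalizer_fintype fun n hn => ?_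
      exact Subgroup.zpowers_le.mpr hn
        (h q hq.out M hMn hM x hx n (Subgroup.zpowers_le.mpr w.2 hn))
  · rw [Nat.card_zpowers, Subgroup.orderOf_coe, hwo]

/-- Descending the derived series reaches an abelian normal subgroup, whose Sylow subgroups are
normal in G. -/
theorem HasNormalPowerAction.exists_prime_card_le [Group.IsSolvable G] (h : HasNormalPowerAction G)
    (A : Subgroup G) (hA : A.Normal) (hA1 : A ≠ ⊥) :
    ∃ N ≤ A, N.Normal ∧ (Nat.card N).Prime := by
  induction hn : Nat.card A using Nat.strong_induction_on generalizing A with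
  | _ n ih =>
  have hlt := Group.IsSolvable.commutator_lt_of_ne_bot hA1
  by_cases hc : ⁅A, A⁆ = ⊥
  · obtain ⟨q, hq, hqA⟩ := Nat.exists_prime_and_dvd
      (fun e => hA1 (Subgroup.card_eq_one.mp e) : Nat.card A ≠ 1)
    have := Fact.mk hq
    let Q : Sylow q A := default
    have hQn : (Q : Subgroup A).Normal := by
      refine ⟨fun a ha g => ?_⟩
      have : g * a = a * g := Subtype.ext (by
        have := Subgroup.commutator_mem_commutator g.2 a.2
        rw [hc, Subgroup.mem_bot, commutatorElement_eq_one_iff_mul_comm] at this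
        exact this)
      rwa [this, mul_inv_cancel_right]
    have hQc : (Q : Subgroup A).Characteristic := Q.characteristic_of_normal hQn
    have hMn : ((Q : Subgroup A).map A.subtype).Normal := inferInstance
    have hM1 : (Q : Subgroup A).map A.subtype ≠ ⊥ := by
      rw [ne_eq, Subgroup.map_eq_bot_iff_of_injective _ A.subtype_injective]
      exact Q.ne_bot_of_dvd_card hqA
    obtain ⟨N, hNM, hN, hNc⟩ := h.exists_prime_card_le_of_isPGroup (Q.2.map A.subtype) hM1
    exact ⟨N, hNM.trans (Subgroup.map_subtype_le _), hN, hNc ▸ hq⟩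
  · obtain ⟨N, hN, h1, h2⟩ := ih _ (hn ▸ Set.Finite.card_lt_card (Set.toFinite _) hlt) ⁅A, A⁆
      inferInstance hc rfl
    exact ⟨N, hN.trans hlt.le, h1, h2⟩

/-- If all p'-elements centralise P, a Schur–Zassenhaus complement is normal. Otherwise P is
abelian, and its cyclic subgroups are normalised both by P and by all p'-elements. -/
theorem HasNormalPowerAction.of_normal_sylow (h : HasNormalPowerAction G) {p : ℕ}
    [hp : Fact p.Prime] {P : Subgroup G} (hPn : P.Normal) (hP : IsPGroup p P) (hPi : ¬ p ∣ P.index) :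
    HasNormalComplement p G ∨ HasPowerSylow p G := by
  have hact : ∀ x : G, (orderOf x).Coprime p → ∀ k ∈ P, x * k * x⁻¹ ∈ Subgroup.zpowers k :=
    h p hp.out P hPn hP
  have hN : Subgroup.normalizer (P : Set G) = ⊤ := Subgroup.normalizer_eq_top_iff.mpr hPn
  by_cases hc : ∀ x : G, (orderOf x).Coprime p → ∀ k ∈ P, x * k = k * x
  · left
    obtain ⟨n, hn⟩ := IsPGroup.iff_card.mp hP
    obtain ⟨A, hA⟩ := Subgroup.exists_right_complement'_of_coprime (N := P) (by
      rw [hn]; exact (hp.out.coprime_iff_not_dvd.mpr hPi).pow_left n)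
    have hAc : ¬ p ∣ Nat.card A := hA.symm.index_eq_card ▸ hPi
    refine ⟨A, ?_, hAc, n, by rw [hA.index_eq_card, hn]⟩
    rw [← Subgroup.normalizer_eq_top_iff, eq_top_iff, ← hA.sup_eq_top]
    refine sup_le (fun k hk => Subgroup.mem_normalizer_fintype fun a ha => ?_)
      Subgroup.le_normalizer
    have hac : (orderOf a).Coprime p := by
      refine Nat.Coprime.coprime_dvd_left (Subgroup.orderOf_dvd_natCard A ha) ?_
      exact (hp.out.coprime_iff_not_dvd.mpr hAc).symm
    rw [← hc a hac k hk, mul_inv_cancel_right]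
    exact ha
  · right
    push Not at hc
    obtain ⟨x, hx, k, hk, hne⟩ := hc
    rcases hP.commute_or_comm_of_conj_mem_zpowers (x := x) (hN ▸ Subgroup.mem_top x) hx
      (hact x hx) with h1 | ⟨h1, -⟩
    · exact absurd (h1 k hk) hne
    refine ⟨P, hPn, hP, hPi, h1, fun a ha g => ?_⟩
    have htop : Subgroup.normalizer (Subgroup.zpowers a : Set G) = ⊤ := by
      refine (hP.toSylow hPi).eq_top_of_le_of_coprime_mem (fun s hs => ?_) fun x hx => ?_
      · refine Subgroup.mem_normalizer_fintype fun n hn => ?_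
        rw [h1 s hs n (Subgroup.zpowers_le.mpr ha hn), mul_inv_cancel_right]
        exact hn
      · refine Subgroup.mem_normalizer_fintype fun n hn => ?_
        exact Subgroup.zpowers_le.mpr hn (hact x hx n (Subgroup.zpowers_le.mpr ha hn))
    exact (Subgroup.mem_normalizer_iff.mp (htop ▸ Subgroup.mem_top g) a).mp (Subgroup.mem_zpowers a)

/-- The quotient by the centraliser embeds in Aut(N), of order p - 1. -/
theorem Subgroup.not_dvd_index_centralizer {p : ℕ} (hp : p.Prime) {N : Subgroup G} [N.Normal]
    (hN : Nat.card N = p) : ¬ p ∣ (centralizer (N : Set G)).index := by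
  have := Fact.mk hp
  have hcyc : IsCyclic N := isCyclic_of_prime_card hN
  have hker : (MulAut.conjNormal (H := N)).ker = centralizer (N : Set G) := by
    ext g
    rw [MonoidHom.mem_ker, mem_centralizer_iff]
    constructor
    · intro hg n hn
      have := congrArg Subtype.val (DFunLike.congr_fun hg ⟨n, hn⟩)
      rw [MulAut.conjNormal_apply] at this
      exact (mul_inv_eq_iff_eq_mul.mp this).symm
    · intro hg
      refine MulEquiv.ext fun n => Subtype.ext ?_
      rw [MulAut.conjNormal_apply]
      exact mul_inv_eq_iff_eq_mul.mpr (hg n n.2).symm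
  rw [← hker, index_ker]
  intro hd
  have h1 := hd.trans (card_subgroup_dvd_card (MulAut.conjNormal (H := N)).range)
  rw [hcyc.card_mulAut, hN, Nat.totient_prime hp] at h1
  have := Nat.le_of_dvd (by have := hp.two_le; lia) h1
  have := hp.two_le
  lia

/-- A quotient by a normal subgroup of order prime to `p` with a normal Sylow `p`-subgroup of power
type forces either a normal `p`-complement or a Sylow `p`-subgroup of power type. -/
theorem HasPowerSylow.of_quotient {p : ℕ} [hp : Fact p.Prime] {N : Subgroup G} [N.Normal]
    [IsCyclic N] (hN : ¬ p ∣ Nat.card N) (h : HasPowerSylow p (G ⧸ N)) :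
    HasNormalComplement p G ∨ HasPowerSylow p G := by
  obtain ⟨P', hP'n, hP', hP'i, hP'c, hP'z⟩ := h
  let P : Sylow p G := default
  have hmk : ∀ a ∈ P, (a : G ⧸ N) ∈ P' := fun a ha => by
    refine Subgroup.mem_of_coprime_orderOf_index ?_
    obtain ⟨e, he⟩ := IsPGroup.iff_orderOf.mp P.2 ⟨a, ha⟩
    rw [Subgroup.orderOf_mk] at he
    refine Nat.Coprime.coprime_dvd_left (orderOf_map_dvd (QuotientGroup.mk' N) a) ?_
    rw [he]
    exact (hp.out.coprime_iff_not_dvd.mpr hP'i).pow_left e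
  obtain ⟨n, hn⟩ := IsPGroup.iff_card.mp P.2
  have hdisj : Disjoint (P : Subgroup G) N := Subgroup.disjoint_of_coprime_natCard (by
    rw [hn]; exact (hp.out.coprime_iff_not_dvd.mpr hN).pow_left n)
  have hinj : ∀ a ∈ P, ∀ b ∈ P, (a : G ⧸ N) = b → a = b := fun a ha b hb e => by
    have h1 := QuotientGroup.eq.mp e
    exact inv_mul_eq_one.mp (Subgroup.disjoint_def.mp hdisj (mul_mem (inv_mem ha) hb) h1)
  have hcomm : ∀ a ∈ P, ∀ b ∈ P, a * b = b * a := fun a ha b hb =>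
    hinj _ (mul_mem ha hb) _ (mul_mem hb ha) (hP'c _ (hmk a ha) _ (hmk b hb))
  have hconj : ∀ a ∈ P, ∀ g, g * a * g⁻¹ ∈ P → g * a * g⁻¹ ∈ Subgroup.zpowers a := by
    intro a ha g hg
    obtain ⟨i, hi⟩ := Subgroup.mem_zpowers_iff.mp (hP'z a (hmk a ha) g)
    exact Subgroup.mem_zpowers_iff.mpr ⟨i, hinj _ (zpow_mem ha i) _ hg hi⟩
  -- Under this inclusion Burnside's transfer theorem supplies the normal p-complement.
  by_cases hC : Subgroup.normalizer (P : Set G) ≤ Subgroup.centralizer (P : Set G)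
  · left
    have hcomp := MonoidHom.ker_transferSylow_isComplement' P hC
    exact ⟨_, inferInstance, MonoidHom.not_dvd_card_ker_transferSylow P hC, n,
      by rw [hcomp.symm.index_eq_card]; exact hn⟩
  right
  -- Suppose k in P does not centralise N. A p'-element x of N(P) acting nontrivially on P would
  -- make k a power of its commutator with x, which centralises N because Aut(N) is abelian. So
  -- every such x centralises P, contrary to the case assumption.
  have hPN : ∀ k ∈ P, ∀ m ∈ N, k * m = m * k := by
    by_contra hcon
    push Not at hcon
    obtain ⟨k, hk, m, hm, hne⟩ := hcon
    refine hC ?_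
    suffices (Subgroup.centralizer (P : Set G)).subgroupOf (Subgroup.normalizer (P : Set G)) = ⊤ from
      Subgroup.subgroupOf_eq_top.mp this
    refine (P.subtype Subgroup.le_normalizer).eq_top_of_le_of_coprime_mem (fun s hs => ?_)
      fun x hx => ?_
    · exact Subgroup.mem_centralizer_iff.mpr fun b hb => hcomm b hb s hs
    · rw [← Subgroup.orderOf_coe] at hx
      rcases P.2.commute_or_comm_of_conj_mem_zpowers x.2 hx
        (fun a ha => hconj a ha x ((Subgroup.mem_normalizer_iff.mp x.2 a).mp ha)) with h1 | ⟨-, h1⟩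
      · exact Subgroup.mem_centralizer_iff.mpr fun b hb => (h1 b hb).symm
      · have hcent : (x : G) * k * (x : G)⁻¹ * k⁻¹ ∈ Subgroup.centralizer (N : Set G) :=
          Subgroup.mem_centralizer_iff.mpr fun m hm =>
            (N.commutator_commute_of_isCyclic x k hm).symm
        exact absurd (Subgroup.mem_centralizer_iff.mp
          (Subgroup.zpowers_le.mpr hcent (h1 k hk)) m hm).symm hne
  have hPn : ∀ a ∈ P, ∀ g, g * a * g⁻¹ ∈ P := by
    intro a ha g
    have h1 : ((g * a * g⁻¹ : G) : G ⧸ N) ∈ P' := hP'n.conj_mem _ (hmk a ha) g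
    have hPP' : (P : Subgroup G).map (QuotientGroup.mk' N) = P' :=
      (P.mapSurjective (QuotientGroup.mk'_surjective N)).3 hP' (by
        rintro _ ⟨a, ha, rfl⟩; exact hmk a ha) |>.symm
    rw [← hPP'] at h1
    obtain ⟨b, hb, hbe⟩ := h1
    have hbN : b⁻¹ * (g * a * g⁻¹) ∈ N := QuotientGroup.eq.mp hbe
    have hpow : ∀ c ∈ P, c ^ p ^ n = 1 := fun c hc =>
      orderOf_dvd_iff_pow_eq_one.mp (hn ▸ Subgroup.orderOf_dvd_natCard _ hc)
    -- The conjugate of a is b times an element of N commuting with b; its p-power order forces the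
    -- factor in N to be trivial.
    have h2 : b⁻¹ * (g * a * g⁻¹) = 1 := by
      refine Commute.right_eq_one_of_coprime (b := b) (hPN b hb _ hbN)
        ((hp.out.coprime_iff_not_dvd.mpr hN).pow_left n) ?_ (hpow b hb)
        (orderOf_dvd_iff_pow_eq_one.mp (Subgroup.orderOf_dvd_natCard _ hbN))
      rw [mul_inv_cancel_left, conj_pow, hpow a ha, mul_one, mul_inv_cancel]
    rw [← inv_mul_eq_one.mp h2]
    exact hb
  exact ⟨P, ⟨fun a ha g => hPn a ha g⟩, P.2, P.not_dvd_index, hcomm,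
    fun a ha g => hconj a ha g (hPn a ha g)⟩

end

/-- Induction through a normal subgroup N of prime order. If N can be chosen of order prime to p,
either alternative for the quotient leads back to one for G. Otherwise |N| = p and G has a normal
Sylow p-subgroup: the centraliser of N if the quotient is p-nilpotent, else the preimage of the
Sylow subgroup of the quotient. -/
theorem HasQuotientPowerAction.hasNormalComplement_or_hasPowerSylow {G : Type u} [Group G]
    [Finite G] (hsol : Group.IsSolvable G) (h : HasQuotientPowerAction G) {p : ℕ} (hp : p.Prime) :
    HasNormalComplement p G ∨ HasPowerSylow p G := by
  suffices H : ∀ n : ℕ, ∀ (G : Type u) [Group G] [Finite G], Nat.card G = n → Group.IsSolvable G →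
      HasQuotientPowerAction G → HasNormalComplement p G ∨ HasPowerSylow p G from
    H _ G rfl hsol h
  intro n
  have := Fact.mk hp
  induction n using Nat.strong_induction_on with
  | _ n ih =>
  intro G _ _ hn hsol h
  have hquot : ∀ N : Subgroup G, [N.Normal] → (Nat.card N).Prime →
      HasNormalComplement p (G ⧸ N) ∨ HasPowerSylow p (G ⧸ N) := by
    intro N _ hN
    refine ih _ ?_ (G ⧸ N) rfl inferInstance
      (h.of_surjective _ (QuotientGroup.mk'_surjective N))
    rw [← hn, ← N.card_mul_index, ← N.index_eq_card]
    exact lt_mul_of_one_lt_left (Nat.pos_of_ne_zero N.index_ne_zero_of_finite) hN.one_lt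
  by_cases hO : ∀ A : Subgroup G, A.Normal → ¬ p ∣ Nat.card A → A = ⊥
  · rcases subsingleton_or_nontrivial G with hs | hs
    · exact Or.inl ⟨⊥, inferInstance, by rw [Subgroup.card_bot]; exact hp.not_dvd_one, 0,
        by rw [Subgroup.index_bot, Nat.card_of_subsingleton (1 : G), pow_zero]⟩
    obtain ⟨N, -, hNn, hNp⟩ := h.hasNormalPowerAction.exists_prime_card_le ⊤ inferInstance top_ne_bot
    have hN : Nat.card N = p := by
      by_contra hne
      have := hO N hNn fun hd => hne ((Nat.prime_dvd_prime_iff_eq hp hNp).mp hd).symm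
      rw [this, Subgroup.card_bot] at hNp
      exact Nat.not_prime_one hNp
    rcases hquot N hNp with h1 | ⟨P', hP'n, hP', hP'i, -⟩
    · exact h.hasNormalPowerAction.of_normal_sylow inferInstance
        (h1.isPGroup_centralizer hp hN hO) (Subgroup.not_dvd_index_centralizer hp hN)
    · refine h.hasNormalPowerAction.of_normal_sylow
        (inferInstance : (P'.comap (QuotientGroup.mk' N)).Normal)
        (hP'.comap_of_ker_isPGroup _ ?_) ?_
      · rw [QuotientGroup.ker_mk']
        exact IsPGroup.of_card (n := 1) (by rw [hN, pow_one])
      · rwa [P'.index_comap_of_surjective (QuotientGroup.mk'_surjective N)]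
  · push Not at hO
    obtain ⟨A, hA, hAc, hA1⟩ := hO
    obtain ⟨N, hNA, hNn, hNp⟩ := h.hasNormalPowerAction.exists_prime_card_le A hA hA1
    have hN : ¬ p ∣ Nat.card N := fun hd => hAc (hd.trans (Subgroup.card_dvd_of_le hNA))
    have := Fact.mk hNp
    have : IsCyclic N := isCyclic_of_prime_card rfl
    rcases hquot N hNp with h1 | h1
    · exact Or.inl (h1.of_quotient hp hN)
    · exact h1.of_quotient hN

/-- L is the intersection of normal p-complements M p over the primes without a Sylow subgroup of
power type. A prime r dividing |L| is then of power type, and its normal Sylow subgroup lies in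
every M p, so L is Hall. Of two elements of coprime orders, one lies in M p, hence so does their
commutator. -/
theorem HasQuotientPowerAction.exists_isPowerHall {G : Type u} [Group G]
    [Finite G] (hsol : Group.IsSolvable G) (h : HasQuotientPowerAction G) :
    ∃ L : Subgroup G, L.IsPowerHall := by
  have hM : ∀ p : {p : ℕ // p.Prime ∧ ¬ HasPowerSylow p G}, HasNormalComplement p G := fun p =>
    (h.hasNormalComplement_or_hasPowerSylow hsol p.2.1).resolve_right p.2.2
  choose M hMn hMc e hMi using hM
  have hMmem : ∀ p (x : G), (orderOf x).Coprime p.1 → x ∈ M p := fun p x hx => by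
    have := hMn p
    refine Subgroup.mem_of_coprime_orderOf_index ?_
    rw [hMi]
    exact hx.pow_right _
  have hLn : (⨅ p, M p).Normal := Subgroup.normal_iInf_normal hMn
  have hpow : ∀ r, r.Prime → r ∣ Nat.card (⨅ p, M p : Subgroup G) → HasPowerSylow r G := by
    intro r hr hrL
    by_contra hcon
    exact hMc ⟨r, hr, hcon⟩ (hrL.trans (Subgroup.card_dvd_of_le (iInf_le _ _)))
  choose! P hPn hPp hPi hPc hPz using hpow
  have hmemP : ∀ r k, r.Prime → r ∣ Nat.card (⨅ p, M p : Subgroup G) → ∀ a : G,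
      orderOf a = r ^ k → a ∈ P r := by
    intro r k hr hrL a ha
    have := hPn r hr hrL
    refine Subgroup.mem_of_coprime_orderOf_index ?_
    rw [ha]
    exact (hr.coprime_iff_not_dvd.mpr (hPi r hr hrL)).pow_left k
  have hdvd : ∀ r k, ∀ a ∈ (⨅ p, M p : Subgroup G), orderOf a = r ^ k → a ≠ 1 →
      r ∣ Nat.card (⨅ p, M p : Subgroup G) := by
    intro r k a ha hao ha1
    refine dvd_trans ?_ (Subgroup.orderOf_dvd_natCard _ ha)
    rw [hao]
    refine dvd_pow_self r fun hk => ha1 ?_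
    rw [hk, pow_zero] at hao
    exact orderOf_eq_one_iff.mp hao
  refine ⟨⨅ p, M p, hLn, ?_, ?_, ?_, ?_⟩
  · refine Nat.coprime_of_dvd fun r hr hrL hri => hPi r hr hrL (hri.trans ?_)
    refine Subgroup.index_dvd_of_le (le_iInf fun p => ?_)
    have := Fact.mk hr
    have := hPn r hr hrL
    refine (hPp r hr hrL).le_of_normal_of_not_dvd_index ?_
    rw [hMi]
    intro hd
    have hrp := (Nat.prime_dvd_prime_iff_eq hr p.2.1).mp (hr.dvd_of_dvd_pow hd)
    exact p.2.2 (hrp ▸ ⟨P r, hPn r hr hrL, hPp r hr hrL, hPi r hr hrL, hPc r hr hrL, hPz r hr hrL⟩)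
  · have key : ∀ r k, r.Prime → ∀ a ∈ (⨅ p, M p : Subgroup G), orderOf a = r ^ k →
        ∀ s j, s.Prime → ∀ b ∈ (⨅ p, M p : Subgroup G), orderOf b = s ^ j → a * b = b * a := by
      intro r k hr a ha hao s j hs b hb hbo
      by_cases ha1 : a = 1
      · rw [ha1, one_mul, mul_one]
      by_cases hb1 : b = 1
      · rw [hb1, one_mul, mul_one]
      have hrL := hdvd r k a ha hao ha1
      have hsL := hdvd s j b hb hbo hb1
      have haP := hmemP r k hr hrL a hao
      have hbP := hmemP s j hs hsL b hbo
      by_cases hrs : r = s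
      · exact hPc r hr hrL a haP b (hrs ▸ hbP)
      · have := Fact.mk hr
        have := Fact.mk hs
        have hd := IsPGroup.disjoint_of_ne r s hrs _ _ (hPp r hr hrL) (hPp s hs hsL)
        exact (Subgroup.commute_of_normal_of_disjoint _ _ (hPn r hr hrL) (hPn s hs hsL) hd a b
          haP hbP).eq
    intro a ha b hb
    have h1 : (⨅ p, M p : Subgroup G) ≤
        Subgroup.centralizer ((⨅ p, M p : Subgroup G) : Set G) := by
      refine Subgroup.le_of_forall_prime_pow_orderOf fun r k hr a ha hao => ?_
      have h2 : (⨅ p, M p : Subgroup G) ≤ Subgroup.centralizer {a} :=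
        Subgroup.le_of_forall_prime_pow_orderOf fun s j hs b hb hbo =>
          Subgroup.mem_centralizer_singleton_iff.mpr (key s j hs b hb hbo r k hr a ha hao)
      exact Subgroup.mem_centralizer_iff.mpr fun b hb =>
        Subgroup.mem_centralizer_singleton_iff.mp (h2 hb)
    exact (Subgroup.mem_centralizer_iff.mp (h1 hb) a ha)
  · intro a ha g
    suffices Subgroup.zpowers a ≤ (Subgroup.zpowers a).comap (MulAut.conj g).toMonoidHom from
      this (Subgroup.mem_zpowers a)
    refine Subgroup.le_of_forall_prime_pow_orderOf fun r k hr y hy hyo => ?_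
    change g * y * g⁻¹ ∈ Subgroup.zpowers a
    by_cases hy1 : y = 1
    · rw [hy1, mul_one, mul_inv_cancel]; exact one_mem _
    have hrL := hdvd r k y (Subgroup.zpowers_le.mpr ha hy) hyo hy1
    exact Subgroup.zpowers_le.mpr hy (hPz r hr hrL y (hmemP r k hr hrL y hyo) g)
  · intro x y hxy
    refine Subgroup.mem_iInf.mpr fun p => ?_
    by_cases hx : (orderOf x).Coprime p.1
    · have h1 := hMmem p x hx
      rw [show x * y * x⁻¹ * y⁻¹ = x * (y * x⁻¹ * y⁻¹) by group]
      exact mul_mem h1 ((hMn p).conj_mem _ (inv_mem h1) y)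
    · have hpx : p.1 ∣ orderOf x := by
        by_contra hd
        exact hx (p.2.1.coprime_iff_not_dvd.mpr hd).symm
      have h1 := hMmem p y (hxy.symm.coprime_dvd_right hpx)
      exact mul_mem ((hMn p).conj_mem _ h1 x) (inv_mem h1)

/-- An element of order prime to `p` lifts along a homomorphism to an element of order prime to `p`
among the powers of any given lift. -/
theorem exists_zpowers_lift_coprime {G G' : Type*} [Group G] [Group G'] [Finite G] (f : G →* G')
    {p : ℕ} (hp : p.Prime) (n : G) (hx : (orderOf (f n)).Coprime p) :
    ∃ m ∈ Subgroup.zpowers n, f m = f n ∧ (orderOf m).Coprime p := by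
  obtain ⟨a, b, hb, hab⟩ := Nat.exists_eq_pow_mul_and_not_dvd (orderOf_pos n).ne' p hp.ne_one
  -- The exponent j is 1 modulo the order of f n and 0 modulo the p-part of the order of n.
  obtain ⟨j, hj1, hj2⟩ := Nat.chineseRemainder (hx.pow_right a) 1 0
  refine ⟨n ^ j, pow_mem (Subgroup.mem_zpowers n) j, ?_, ?_⟩
  · rw [map_pow, pow_eq_pow_iff_modEq.mpr hj1, pow_one]
  · refine Nat.Coprime.coprime_dvd_left (orderOf_dvd_of_pow_eq_one (n := b) ?_)
      (hp.coprime_iff_not_dvd.mpr hb).symm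
    rw [← pow_mul, ← orderOf_dvd_iff_pow_eq_one, hab]
    exact mul_dvd_mul_right (Nat.modEq_zero_iff_dvd.mp hj2) b

/-- A Sylow p-subgroup S of the preimage of K' maps onto K', so the Frattini argument gives G = N(S)
ker f. Hence x' lifts to a p'-element normalising S, where the local condition applies. -/
theorem HasLocalPowerAction.hasQuotientPowerAction {G : Type u} [Group G] [Finite G]
    (h : HasLocalPowerAction G) : HasQuotientPowerAction G := by
  intro G' _ f hf p hp K' hK'n hK' x' hx' k' hk'
  have := Fact.mk hp
  have : Finite G' := Finite.of_surjective f hf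
  let K := K'.comap f
  let S : Sylow p K := default
  have hSK : ∀ y ∈ K', ∃ s ∈ (S : Subgroup K).map K.subtype, f s = y := by
    intro y hy
    have hsurj := MonoidHom.subgroupComap_surjective_of_surjective f K' hf
    have htop : (S.mapSurjective hsurj : Subgroup K') = ⊤ :=
      ((S.mapSurjective hsurj).3 (hK'.to_subgroup ⊤) le_top).symm
    obtain ⟨s, hs, e⟩ : (⟨y, hy⟩ : K') ∈ (S.mapSurjective hsurj : Subgroup K') :=
      htop ▸ Subgroup.mem_top _
    exact ⟨s, Subgroup.mem_map_of_mem _ hs, congrArg Subtype.val e⟩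
  set N := Subgroup.normalizer (((S : Subgroup K).map K.subtype : Subgroup G) : Set G) with hN
  have hfrat : N ⊔ f.ker = ⊤ := by
    rw [eq_top_iff, ← Sylow.normalizer_sup_eq_top S]
    refine sup_le le_sup_left fun k hk => ?_
    obtain ⟨s, hs, e⟩ := hSK (f k) hk
    rw [← mul_inv_cancel_left s k]
    refine mul_mem (Subgroup.mem_sup_left (Subgroup.le_normalizer hs)) (Subgroup.mem_sup_right ?_)
    rw [MonoidHom.mem_ker, map_mul, map_inv, e, inv_mul_cancel]
  obtain ⟨x, rfl⟩ := hf x'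
  obtain ⟨n, hn, m, hm, rfl⟩ := Subgroup.mem_sup_of_normal_right.mp (hfrat ▸ Subgroup.mem_top x)
  rw [map_mul, MonoidHom.mem_ker.mp hm, mul_one] at hx' ⊢
  obtain ⟨y, hy, hye, hyo⟩ := exists_zpowers_lift_coprime f hp n hx'
  obtain ⟨s, hs, rfl⟩ := hSK k' hk'
  obtain ⟨i, hi⟩ := Subgroup.mem_zpowers_iff.mp
    (h p hp _ (S.2.map _) y (Subgroup.zpowers_le.mpr hn hy) hyo s hs)
  refine Subgroup.mem_zpowers_iff.mpr ⟨i, ?_⟩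
  rw [← hye, ← map_inv, ← map_mul, ← map_mul, ← map_zpow, hi]

/-! ### Power actions from the PST property and from SS-permutability -/

theorem IsPSTGroup.isSPermutable_comap {G G' : Type*} [Group G] [Group G'] [Finite G']
    (h : IsPSTGroup G) (f : G →* G') {p : ℕ} (hp : p.Prime) {K : Subgroup G'} (hKn : K.Normal)
    (hK : IsPGroup p K) (H : Subgroup G') (hHK : H ≤ K) : (H.comap f).IsSPermutable := by
  have := Fact.mk hp
  induction hn : Nat.card G' - Nat.card H using Nat.strong_induction_on generalizing H with
  | _ n ih =>
  rcases hHK.eq_or_lt with rfl | hlt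
  · exact fun q _ Q => Subgroup.PermutesWith.of_normal_left _ _
  obtain ⟨g, hgK, hgN, hgH⟩ := hK.exists_mem_normalizer_of_lt hlt
  -- Climbing by normalisers: the preimage of H is normal in that of J = N_K(H), which is
  -- S-permutable by induction, and PST transfers this to H.
  set J := Subgroup.normalizer (H : Set G') ⊓ K
  have hHJ : H < J := lt_of_le_of_ne (le_inf Subgroup.le_normalizer hHK) fun e =>
    hgH (e ▸ (⟨hgN, hgK⟩ : g ∈ J))
  have hc1 : Nat.card H < Nat.card J := Set.Finite.card_lt_card (Set.toFinite _) hHJ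
  have hc2 := Subgroup.card_le_card_group J
  have hJ := ih _ (by lia) J inf_le_right rfl
  refine h _ _ (Subgroup.comap_mono hHJ.le) ?_ hJ
  have : ((H.comap f).subgroupOf (J.comap f)).Normal := by
    rw [Subgroup.normal_subgroupOf_iff (Subgroup.comap_mono hHJ.le)]
    intro a j ha hj
    have hj' : f j ∈ Subgroup.normalizer (H : Set G') := hj.1
    rw [Subgroup.mem_comap, map_mul, map_mul, map_inv]
    exact (Subgroup.mem_normalizer_iff.mp hj' (f a)).mp ha
  exact fun q _ Q => Subgroup.PermutesWith.of_normal_left _ _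

theorem orderOf_eq_prime_pow_ne {G : Type*} [Group G] {x y : G} {p q e : ℕ}
    (hx : (orderOf x).Coprime p) (hp : p.Prime) (hy : y ∈ Subgroup.zpowers x)
    (hyo : orderOf y = q ^ e) (hy1 : y ≠ 1) : p ≠ q := by
  rintro rfl
  have hd : orderOf y ∣ orderOf x := orderOf_dvd_of_mem_zpowers hy
  have he : e ≠ 0 := fun h => hy1 (orderOf_eq_one_iff.mp (by rw [hyo, h, pow_zero]))
  have h1 : p ∣ orderOf x := (dvd_pow_self p he).trans (hyo ▸ hd)
  exact hp.ne_one (Nat.eq_one_of_dvd_coprimes hx h1 dvd_rfl)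

/-- Sylow subgroups of the image are images of Sylow subgroups, so ⟨k⟩ permutes with them; for q ≠
p, permuting inside a normal p-subgroup means normalising. -/
theorem IsPSTGroup.hasQuotientPowerAction {G : Type u} [Group G] [Finite G] (h : IsPSTGroup G) :
    HasQuotientPowerAction G := by
  intro G' _ f hf p hp K hKn hK x hx k hk
  have := Fact.mk hp
  have : Finite G' := Finite.of_surjective f hf
  have hzK : Subgroup.zpowers k ≤ K := Subgroup.zpowers_le.mpr hk
  have hperm := h.isSPermutable_comap f hp hKn hK _ hzK
  suffices x ∈ Subgroup.normalizer (Subgroup.zpowers k : Set G') from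
    (Subgroup.mem_normalizer_iff.mp this k).mp (Subgroup.mem_zpowers k)
  refine Subgroup.mem_of_forall_prime_pow_orderOf _ x fun q e hq y hy hyo => ?_
  by_cases hy1 : y = 1
  · rw [hy1]; exact one_mem _
  have hpq := orderOf_eq_prime_pow_ne hx hp hy hyo hy1
  have := Fact.mk hq
  obtain ⟨Q', hQ'⟩ := Sylow.exists_mem_of_orderOf_eq hyo
  obtain ⟨Q, rfl⟩ := Sylow.mapSurjective_surjective hf q Q'
  have hpm := (hperm q hq Q).map f
  rw [Subgroup.map_comap_eq_self_of_surjective hf] at hpm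
  refine Subgroup.mem_normalizer_fintype fun z hz => ?_
  exact hpm.conj_mem hpq hK (Q.2.map f) hzK
    (by rw [Subgroup.normalizer_eq_top_iff.mpr hKn]; exact le_top) hQ' hz

/-- An SS-permutable subgroup of a normal `p`-subgroup is normalised by the elements of order prime
to `p`. -/
theorem Subgroup.IsSSPermutable.mem_normalizer {N : Type*} [Group N] [Finite N] {p : ℕ}
    (hp : p.Prime) {H K : Subgroup N} (hKn : K.Normal) (hK : IsPGroup p K) (hHK : H ≤ K)
    (h : H.IsSSPermutable) {x : N} (hx : (orderOf x).Coprime p) :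
    x ∈ normalizer (H : Set N) := by
  have := Fact.mk hp
  obtain ⟨S, hS, hperm⟩ := h
  refine mem_of_forall_prime_pow_orderOf _ x fun q e hq y hy hyo => ?_
  by_cases hy1 : y = 1
  · rw [hy1]; exact one_mem _
  have hpq := orderOf_eq_prime_pow_ne hx hp hy hyo hy1
  have := Fact.mk hq
  let R₀ : Sylow q S := default
  obtain ⟨R, hR⟩ := Sylow.exists_le_of_not_dvd_index
    (not_dvd_index_of_isSupplement hS hpq (hK.to_le hHK)) R₀
  obtain ⟨Q, hQ⟩ := Sylow.exists_mem_of_orderOf_eq hyo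
  obtain ⟨g, rfl⟩ := MulAction.exists_smul_eq N R Q
  -- Conjugating R by s gives another Sylow subgroup of S, which normalises H; the remaining
  -- conjugation by a in H stays inside the normaliser of H.
  obtain ⟨a, ha, s, hs, rfl⟩ : g ∈ (H : Set N) * S := by rw [hS]; trivial
  have hr : (a * s)⁻¹ * y * (a * s) ∈ (R : Subgroup N) := by
    have := (mem_pointwise_smul_iff_inv_smul_mem (a := MulAut.conj (a * s))
      (S := (R : Subgroup N))).mp hQ
    rwa [← map_inv, MulAut.smul_def, MulAut.conj_apply, inv_inv] at this
  rw [hR] at hr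
  obtain ⟨r, hr, hre⟩ := hr
  have hmem : s * (r : N) * s⁻¹ ∈ normalizer (H : Set N) := by
    refine mem_normalizer_fintype fun z hz => ?_
    refine (hperm q hq ((⟨s, hs⟩ : S) • R₀)).conj_mem hpq hK (((⟨s, hs⟩ : S) • R₀).2.map _) hHK
      (by rw [normalizer_eq_top_iff.mpr hKn]; exact le_top) ?_ hz
    refine ⟨⟨s, hs⟩ * r * ⟨s, hs⟩⁻¹, ?_, rfl⟩
    exact smul_mem_pointwise_smul r (MulAut.conj (⟨s, hs⟩ : S)) (R₀ : Subgroup S) hr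
  have haN : a ∈ normalizer (H : Set N) := le_normalizer ha
  have hy : y = a * (s * (r : N) * s⁻¹) * a⁻¹ := by
    rw [show (r : N) = (a * s)⁻¹ * y * (a * s) from hre]
    group
  rw [hy]
  exact mul_mem (mul_mem haN hmem) (inv_mem haN)

/-- A subgroup of a normal `p`-subgroup normalised by all elements of order prime to `p` is
NSS-permutable. -/
theorem Subgroup.isNSSPermutable_of_forall_mem_normalizer {N : Type*} [Group N] [Finite N] {p : ℕ}
    (hp : p.Prime) {H K : Subgroup N} (hKn : K.Normal) (hK : IsPGroup p K) (hHK : H ≤ K)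
    (h : ∀ x : N, (orderOf x).Coprime p → x ∈ normalizer (H : Set N)) : H.IsNSSPermutable := by
  have := Fact.mk hp
  -- The whole group is the supplement: its Sylow p-subgroups contain K, hence H, and its other
  -- Sylow subgroups normalise H.
  refine ⟨⊤, inferInstance, ?_, fun q hq P => ?_⟩
  · refine Set.eq_univ_of_forall fun x => ⟨1, H.one_mem, x, mem_top x, one_mul x⟩
  have := Fact.mk hq
  obtain ⟨R, hR⟩ := Sylow.exists_le_of_not_dvd_index
    (by rw [index_top]; exact hq.not_dvd_one : ¬ q ∣ (⊤ : Subgroup N).index) P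
  rw [← hR]
  by_cases hqp : q = p
  · subst hqp
    have hHR : H ≤ R := hHK.trans (hK.le_sylow_of_normal R)
    exact permutesWith_of_subset fun x hx y hy =>
      ⟨1, H.one_mem, x * y, mul_mem hx (hHR hy), one_mul _⟩
  · refine permutesWith_of_subset fun x hx y hy => ?_
    have hxo : (orderOf x).Coprime p := by
      have := R.2.orderOf_coprime ((Nat.coprime_primes hq hp).mpr hqp) ⟨x, hx⟩
      rwa [orderOf_mk] at this
    exact ⟨x * y * x⁻¹, (mem_normalizer_iff.mp (h x hxo) y).mp hy, x, hx,
      inv_mul_cancel_right _ _⟩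

theorem hasLocalPowerAction_of_isSSPermutable {G : Type*} [Group G] [Finite G]
    (h : ∀ p : ℕ, p.Prime → p ∣ Nat.card G → ∀ H K : Subgroup G, IsPGroup p H → IsPGroup p K →
      H ≤ K → (H.subgroupOf (Subgroup.normalizer (K : Set G))).IsSSPermutable) :
    HasLocalPowerAction G := by
  intro p hp K hK x hx hxp k hk
  have := Fact.mk hp
  by_cases hk1 : k = 1
  · rw [hk1, mul_one, mul_inv_cancel]; exact one_mem _
  have hpG : p ∣ Nat.card G := by
    have := hK.dvd_orderOf (g := ⟨k, hk⟩) (fun e => hk1 (congrArg Subtype.val e))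
    rw [Subgroup.orderOf_mk] at this
    exact this.trans (orderOf_dvd_natCard k)
  have hzK : Subgroup.zpowers k ≤ K := Subgroup.zpowers_le.mpr hk
  have hss := h p hp hpG _ K (hK.to_le hzK) hK hzK
  have hKN : K ≤ Subgroup.normalizer (K : Set G) := Subgroup.le_normalizer
  have hmem := hss.mem_normalizer hp (K := K.subgroupOf (Subgroup.normalizer (K : Set G)))
    inferInstance hK.comap_subtype (Subgroup.comap_mono hzK) (x := ⟨x, hx⟩)
    (by rwa [Subgroup.orderOf_mk])
  exact (Subgroup.mem_normalizer_iff.mp hmem ⟨k, hKN hk⟩).mp (Subgroup.mem_zpowers k)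

theorem HasLocalPowerAction.isNSSPermutable {G : Type*} [Group G] [Finite G]
    (h : HasLocalPowerAction G) {p : ℕ} (hp : p.Prime) {H K : Subgroup G} (hK : IsPGroup p K)
    (hHK : H ≤ K) : (H.subgroupOf (Subgroup.normalizer (K : Set G))).IsNSSPermutable := by
  refine Subgroup.isNSSPermutable_of_forall_mem_normalizer hp
    (K := K.subgroupOf (Subgroup.normalizer (K : Set G))) inferInstance hK.comap_subtype
    (Subgroup.comap_mono hHK) fun x hx => Subgroup.mem_normalizer_fintype fun y hy => ?_
  rw [← Subgroup.orderOf_coe] at hx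
  exact Subgroup.zpowers_le.mpr (show (y : G) ∈ H from hy) (h p hp K hK x x.2 hx y (hHK hy))

theorem theoremC (G : Type*) [Group G] [Finite G] :
    List.TFAE [
      ∀ p : ℕ, p.Prime → p ∣ Nat.card G → ∀ H K : Subgroup G, IsPGroup p H → IsPGroup p K →
        H ≤ K → (H.subgroupOf (Subgroup.normalizer (K : Set G))).IsSSPermutable,
      ∀ p : ℕ, p.Prime → p ∣ Nat.card G → ∀ H K : Subgroup G, IsPGroup p H → IsPGroup p K →
        H ≤ K → (H.subgroupOf (Subgroup.normalizer (K : Set G))).IsNSSPermutable,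
      Group.IsSolvable G ∧ IsPSTGroup G] := by
  tfae_have 2 → 1 := fun h p hp hpG H K hH hK hHK =>
    let ⟨S, _, hS, hperm⟩ := h p hp hpG H K hH hK hHK
    ⟨S, hS, hperm⟩
  tfae_have 1 → 3 := by
    intro h
    have hY := hasLocalPowerAction_of_isSSPermutable h
    have hsol := hY.isSolvable
    obtain ⟨L, hL⟩ := hY.hasQuotientPowerAction.exists_isPowerHall hsol
    exact ⟨hsol, hL.isPSTGroup⟩
  tfae_have 3 → 2 := by
    rintro ⟨hsol, hpst⟩ p hp - H K - hK hHK
    obtain ⟨L, hL⟩ := hpst.hasQuotientPowerAction.exists_isPowerHall hsol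
    exact hL.hasLocalPowerAction.isNSSPermutable hp hK hHK
  tfae_finish
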